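/- Let $\Sigma$ be a closed Riemann surface (for instance a closed oriented surface of genus $g\ge 2$ with a fixed reference complex structure), $K$ its canonical bundle, $\Gamma$ the space of smooth sections, and $n\ge 2$. In a local coordinate $z$ let $\partial=\frac12(\partial_x-i\partial_y)$, $\bar\partial=\frac12(\partial_x+i\partial_y)$, and let $p,\bar p$ be the fibre coordinates of $T^*\Sigma$ for which the real covector $p\,dz+\bar p\,d\bar z$ has coordinate $p$. A compatible $n$-complex structure is a tuple $\mu=(\mu_2,\dots,\mu_n)$ with $\mu_k\in\Gamma(K^{1-k}\otimes\bar K)$ and $|\mu_2|<1$; it is identified with the family of ideals $I(z)=\langle p^n,\,-\bar p+\mu_2(z)p+\dots+\mu_n(z)p^{n-1}\rangle\subset\mathbb C[p,\bar p]$. A higher diffeomorphism is a Hamiltonian diffeomorphism of $T^*\Sigma$ preserving the zero section setwise; it acts on compatible $n$-complex structures through its action on the ideal of smooth functions on $T^*\Sigma$ whose fibrewise Taylor expansion at $0$ lies in $I(z)$ for every $z$. The geometric Hitchin space $\hat{\mathcal T}^n$ is the quotient of the set of compatible $n$-complex structures by the higher diffeomorphisms. A smooth real function $H$ on $T^*\Sigma$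 vanishing on the zero section induces the infinitesimal variation $\delta_H\mu=(\delta_H\mu_2,\dots,\delta_H\mu_n)$, $\delta_H\mu_k\in\Gamma(K^{1-k}\otimes\bar K)$, given by $$\{H,\,-\bar p+\mu_2p+\dots+\mu_np^{n-1}\}\equiv\sum_{k=2}^n\delta_H\mu_k\,p^{k-1}\pmod I .$$ The tangent space $T_\mu\hat{\mathcal T}^n$ is the space of all variations $(\delta\mu_2,\dots,\delta\mu_n)$, $\delta\mu_k\in\Gamma(K^{1-k}\otimes\bar K)$, modulo the variations $\delta_H\mu$. The cotangent space $T^*_\mu\hat{\mathcal T}^n$ is its dual with respect to integration, i.e. the set of tuples $t=(t_2,\dots,t_n)$, $t_k\in\Gamma(K^k)$, such that $\int_\Sigma\sum_{k=2}^n t_k\,\delta_H\mu_k=0$ for all such $H$. The cotangent bundle $T^*\hat{\mathcal T}^n$ is the set of pairs $(\mu,t)$ with $\mu$ a compatible $n$-complex structure and $t\in T^*_\mu\hat{\mathcal T}^n$, modulo the action of the higher diffeomorphisms (which act on $t$ by the dual of their action on variations of $\mu$). **Theorem.** A pair $(\mu,t)=(\mu_2,\dots,\mu_n,t_2,\dots,t_n)$,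 with $\mu$ a compatible $n$-complex structure and $t_k\in\Gamma(K^k)$ for $2\le k\le n$, satisfies $t\in T^*_\mu\hat{\mathcal T}^n$ if and only if for all $k=2,\dots,n$ $$(-\bar\partial+\mu_2\partial+k\,\partial\mu_2)\,t_k+\sum_{l=1}^{n-k}\bigl((l+k)\,\partial\mu_{l+2}+(l+1)\,\mu_{l+2}\,\partial\bigr)t_{k+l}=0 .$$ Consequently $T^*\hat{\mathcal T}^n$ is the set of pairs $(\mu,t)$ satisfying these equations, modulo higher diffeomorphisms, compatibly with the projection $[(\mu,t)]\mapsto[\mu]$ to $\hat{\mathcal T}^n$. For $\mu=0$ the equations say that every $t_k$ is a holomorphic differential, $t_k\in H^0(\Sigma,K^k)$. -/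

import Mathlib

open scoped Manifold ContDiff
open Set

noncomputable section

namespace HigherComplex

/-! ### Wirtinger calculus -/

/-- `∂g = ½ (∂ₓ g - i ∂_y g)` for a function `g` of one complex variable. -/
def dz (g : ℂ → ℂ) (z : ℂ) : ℂ :=
  (1 / 2) * (fderiv ℝ g z 1 - Complex.I * fderiv ℝ g z Complex.I)

/-- `∂̄g = ½ (∂ₓ g + i ∂_y g)` for a function `g` of one complex variable. -/
def dzbar (g : ℂ → ℂ) (z : ℂ) : ℂ :=
  (1 / 2) * (fderiv ℝ g z 1 + Complex.I * fderiv ℝ g z Complex.I)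

/-- The canonical Poisson bracket `{F, G}` of two functions of the coordinates `(z, p)` of the
cotangent bundle, where the real covector with coordinate `p` is `p dz + p̄ dz̄`:
`{F, G} = F_p G_z - F_z G_p + F_p̄ G_z̄ - F_z̄ G_p̄`. -/
def poisson (F G : ℂ → ℂ → ℂ) (z p : ℂ) : ℂ :=
  dz (F z) p * dz (fun z' => G z' p) z - dz (fun z' => F z' p) z * dz (G z) p
    + dzbar (F z) p * dzbar (fun z' => G z' p) z - dzbar (fun z' => F z' p) z * dzbar (G z) p

/-- The Taylor polynomial at `0`, up to total degree `n - 1`, of a smooth function `g` of `p`,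
as a polynomial in the two variables `p = X 0` and `p̄ = X 1`. -/
def fibreTaylor (n : ℕ) (g : ℂ → ℂ) : MvPolynomial (Fin 2) ℂ :=
  ∑ a ∈ Finset.range n, ∑ b ∈ Finset.range (n - a),
    MvPolynomial.C ((dz^[a] (dzbar^[b] g)) 0 / ((a.factorial : ℂ) * (b.factorial : ℂ)))
      * MvPolynomial.X 0 ^ a * MvPolynomial.X 1 ^ b

section Surface

variable (X : Type*) [TopologicalSpace X] [ChartedSpace ℂ X]

/-! ### Differentials on a Riemann surface -/

/-- The space `Γ(K^a ⊗ K̄^b)` of smooth sections: families of smooth functions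
`f_e` on the images of the charts `e` (extended by `0`), such that `f_e dz^a dz̄^b` does not depend
on the chart. -/
def Differential (a b : ℤ) : Submodule ℂ (atlas ℂ X → ℂ → ℂ) where
  carrier := {f |
    (∀ e : atlas ℂ X, ContDiffOn ℝ ∞ (f e) e.1.target) ∧
    (∀ e : atlas ℂ X, ∀ z ∉ e.1.target, f e z = 0) ∧
    (∀ e e' : atlas ℂ X, ∀ z ∈ e.1.target, e.1.symm z ∈ e'.1.source →
      f e z = f e' (e'.1 (e.1.symm z)) * (deriv (fun u => e'.1 (e.1.symm u)) z) ^ a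
        * (starRingEnd ℂ (deriv (fun u => e'.1 (e.1.symm u)) z)) ^ b)}
  zero_mem' := ⟨fun _ => contDiffOn_const, fun _ _ _ => rfl, fun _ _ _ _ _ => by simp⟩
  add_mem' := by
    rintro f g ⟨hf, hf0, hft⟩ ⟨hg, hg0, hgt⟩
    refine ⟨fun e => (hf e).add (hg e), fun e z hz => ?_, fun e e' z hz hz' => ?_⟩
    · simp [hf0 e z hz, hg0 e z hz]
    · simp only [Pi.add_apply]
      rw [hft e e' z hz hz', hgt e e' z hz hz']
      ring
  smul_mem' := by
    rintro c f ⟨hf, hf0, hft⟩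
    refine ⟨fun e => contDiffOn_const.mul (hf e), fun e z hz => ?_, fun e e' z hz hz' => ?_⟩
    · simp [hf0 e z hz]
    · simp only [Pi.smul_apply, smul_eq_mul]
      rw [hft e e' z hz hz']
      ring

/-- Tuples `(δμ₂, …, δμ_n)` with `δμ_k ∈ Γ(K^{1-k} ⊗ K̄)` (entries with other indices are `0`). -/
def Variation (n : ℕ) : Type _ :=
  {δ : ℕ → atlas ℂ X → ℂ → ℂ //
    (∀ k : ℕ, δ k ∈ Differential X (1 - (k : ℤ)) 1) ∧ ∀ k ∉ Finset.Icc 2 n, δ k = 0}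

/-- Tuples `(t₂, …, t_n)` with `t_k ∈ Γ(K^k)` (entries with other indices are `0`). -/
def Covector (n : ℕ) : Type _ :=
  {t : ℕ → atlas ℂ X → ℂ → ℂ //
    (∀ k : ℕ, t k ∈ Differential X (k : ℤ) 0) ∧ ∀ k ∉ Finset.Icc 2 n, t k = 0}

/-- Compatible `n`-complex structures, given by their higher Beltrami differentials
`(μ₂, …, μ_n)`, `μ_k ∈ Γ(K^{1-k} ⊗ K̄)`, with `|μ₂| < 1` everywhere. -/
def CompatibleStructure (n : ℕ) : Type _ :=
  {μ : ℕ → atlas ℂ X → ℂ → ℂ //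
    (∀ k : ℕ, μ k ∈ Differential X (1 - (k : ℤ)) 1) ∧ (∀ k ∉ Finset.Icc 2 n, μ k = 0) ∧
    ∀ e : atlas ℂ X, ∀ z ∈ e.1.target, ‖μ 2 e z‖ < 1}

/-! ### Integration of `(1,1)`-forms -/

section Integral

variable [T2Space X] [CompactSpace X]

theorem exists_chartPartition :
    ∃ ρ : PartitionOfUnity (atlas ℂ X) X univ, ρ.IsSubordinate fun e => e.1.source :=
  PartitionOfUnity.exists_isSubordinate isClosed_univ _ (fun e => e.1.open_source)
    fun x _ => mem_iUnion.2 ⟨⟨chartAt ℂ x, chart_mem_atlas ℂ x⟩, mem_chart_source ℂ x⟩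

/-- A partition of unity subordinate to the charts. -/
def chartPartition : PartitionOfUnity (atlas ℂ X) X univ :=
  Classical.choose (exists_chartPartition X)

variable {X}

/-- The integral over the surface of the `(1,1)`-form that reads `η_e dx dy` in the chart `e`. -/
def surfaceIntegral (η : atlas ℂ X → ℂ → ℂ) : ℂ :=
  ∑ᶠ e : atlas ℂ X, ∫ z in e.1.target, ((chartPartition X e (e.1.symm z) : ℝ) : ℂ) * η e z

/-- The pairing `∫ ∑_k t_k δμ_k`. -/
def pairing {n : ℕ} (t : Covector X n) (δ : Variation X n) : ℂ :=
  surfaceIntegral fun e z => ∑ k ∈ Finset.Icc 2 n, t.1 k e z * δ.1 k e z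

end Integral

/-! ### The real cotangent bundle -/

/-- The real cotangent bundle `T*X` of the surface: pairs of a point and a real-linear form on the
tangent space there. -/
abbrev RealCotangent : Type _ := Σ x : X, (TangentSpace 𝓘(ℂ, ℂ) x →L[ℝ] ℝ)

variable {X}

/-- The point of `T*X` with coordinates `(z, p)` in the chart `e`: the real covector
`p dz + p̄ dz̄ = 2 Re (p dz)`. -/
def covectorAt (e : atlas ℂ X) (z p : ℂ) : RealCotangent X :=
  ⟨e.1.symm z, (2 : ℝ) • Complex.reCLM.comp
    ((p • mfderiv 𝓘(ℂ, ℂ) 𝓘(ℂ, ℂ) e.1 (e.1.symm z) :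
      TangentSpace 𝓘(ℂ, ℂ) (e.1.symm z) →L[ℂ] ℂ).restrictScalars ℝ)⟩

/-- Smoothness of a complex function on `T*X`. -/
def SmoothFun (f : RealCotangent X → ℂ) : Prop :=
  ∀ e : atlas ℂ X, ContDiffOn ℝ ∞ (fun q : ℂ × ℂ => f (covectorAt e q.1 q.2)) (e.1.target ×ˢ univ)

/-- Smoothness of a time-dependent real function on `T*X`. -/
def SmoothTimeFun (H : ℝ → RealCotangent X → ℝ) : Prop :=
  ∀ e : atlas ℂ X, ContDiffOn ℝ ∞
    (fun q : ℝ × ℂ × ℂ => H q.1 (covectorAt e q.2.1 q.2.2)) (univ ×ˢ e.1.target ×ˢ univ)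

variable (X) in
/-- The zero section of `T*X`. -/
def zeroSection : Set (RealCotangent X) := {ξ | ξ.2 = 0}

/-- `φ` is a Hamiltonian diffeomorphism of `T*X`: the time-one map of the flow `Φ` of a
time-dependent Hamiltonian `H`. The flow equation is `d/ds f(Φ_s) = {H_s, f}(Φ_s)` for all smooth
functions `f`. -/
def IsHamiltonianDiffeo (φ : RealCotangent X → RealCotangent X) : Prop :=
  ∃ (H : ℝ → RealCotangent X → ℝ) (Φ : ℝ → RealCotangent X → RealCotangent X),
    SmoothTimeFun H ∧ Φ 0 = id ∧ Φ 1 = φ ∧ (∀ s ∈ Icc (0 : ℝ) 1, Function.Bijective (Φ s)) ∧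
    ∀ f : RealCotangent X → ℂ, SmoothFun f → ∀ s ∈ Icc (0 : ℝ) 1, ∀ ξ : RealCotangent X,
      ∀ e : atlas ℂ X, ∀ z ∈ e.1.target, ∀ p : ℂ, Φ s ξ = covectorAt e z p →
        HasDerivWithinAt (fun r => f (Φ r ξ))
          (poisson (fun z' p' => ((H s (covectorAt e z' p') : ℝ) : ℂ))
            (fun z' p' => f (covectorAt e z' p')) z p) (Icc 0 1) s

/-- A higher diffeomorphism: a Hamiltonian diffeomorphism of `T*X` that preserves the zero section
setwise. -/
def IsHigherDiffeo (φ : RealCotangent X → RealCotangent X) : Prop :=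
  IsHamiltonianDiffeo φ ∧ φ '' zeroSection X = zeroSection X

/-- The Hamiltonian of a higher vector field: a smooth real function on `T*X` vanishing on the
zero section. -/
def IsHigherHamiltonian (H : RealCotangent X → ℝ) : Prop :=
  SmoothFun (fun ξ => (H ξ : ℂ)) ∧ ∀ ξ ∈ zeroSection X, H ξ = 0

/-! ### The ideals of an `n`-complex structure and the action of higher diffeomorphisms -/

/-- The ideal `I(z) = ⟨pⁿ, -p̄ + μ₂ p + ⋯ + μ_n p^{n-1}⟩` of `ℂ[p, p̄]`, where `p = X 0` and
`p̄ = X 1`, at the point with coordinate `z` in the chart `e`. -/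
def structureIdeal {n : ℕ} (μ : CompatibleStructure X n) (e : atlas ℂ X) (z : ℂ) :
    Ideal (MvPolynomial (Fin 2) ℂ) :=
  Ideal.span {MvPolynomial.X 0 ^ n,
    -MvPolynomial.X 1 +
      ∑ k ∈ Finset.Icc 2 n, MvPolynomial.C (μ.1 k e z) * MvPolynomial.X 0 ^ (k - 1)}

/-- The second generator `-p̄ + μ₂ p + ⋯ + μ_n p^{n-1}`, as a function of `(z, p)` in the
chart `e`. -/
def generator {n : ℕ} (μ : CompatibleStructure X n) (e : atlas ℂ X) (z p : ℂ) : ℂ :=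
  -(starRingEnd ℂ p) + ∑ k ∈ Finset.Icc 2 n, μ.1 k e z * p ^ (k - 1)

/-- The fibrewise Taylor expansions of `f` along the zero section belong to the ideals `I(z)`.
(Taylor polynomials of degree `< n` suffice, since `⟨p, p̄⟩ⁿ ⊆ I(z)`.) -/
def InIdeal {n : ℕ} (μ : CompatibleStructure X n) (f : RealCotangent X → ℂ) : Prop :=
  ∀ e : atlas ℂ X, ∀ z ∈ e.1.target,
    fibreTaylor n (fun p => f (covectorAt e z p)) ∈ structureIdeal μ e z

/-- The diffeomorphism `φ` of `T*X` carries the `n`-complex structure `μ` to `μ'`, i.e. pull-back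
of functions by `φ` identifies the ideal of `μ'` with that of `μ`. -/
def Carries {n : ℕ} (φ : RealCotangent X → RealCotangent X) (μ μ' : CompatibleStructure X n) :
    Prop :=
  ∀ f : RealCotangent X → ℂ, SmoothFun f → (InIdeal μ' f ↔ InIdeal μ (f ∘ φ))

variable (X) in
/-- The geometric Hitchin space: compatible `n`-complex structures modulo higher
diffeomorphisms. -/
def GeometricHitchinSpace (n : ℕ) : Type _ :=
  Quot fun μ μ' : CompatibleStructure X n => ∃ φ, IsHigherDiffeo φ ∧ Carries φ μ μ'

/-! ### Cotangent vectors of the geometric Hitchin space -/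

/-- `δ` is the infinitesimal variation of `μ` under the Hamiltonian `H`: the Poisson bracket
`{H, -p̄ + μ₂ p + ⋯ + μ_n p^{n-1}}` is `δμ₂ p + ⋯ + δμ_n p^{n-1}` modulo `I(z)`. (The variation
`{H, pⁿ}` of the other generator is `0` modulo `I(z)`.) -/
def IsHamiltonianVariation {n : ℕ} (μ : CompatibleStructure X n) (H : RealCotangent X → ℝ)
    (δ : Variation X n) : Prop :=
  ∀ e : atlas ℂ X, ∀ z ∈ e.1.target,
    fibreTaylor n
        (poisson (fun z' p' => ((H (covectorAt e z' p') : ℝ) : ℂ)) (generator μ e) z)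
      - ∑ k ∈ Finset.Icc 2 n, MvPolynomial.C (δ.1 k e z) * MvPolynomial.X 0 ^ (k - 1)
      ∈ structureIdeal μ e z

/-- `δ` is the velocity at `s = 0` of the smooth one-parameter family `c` of compatible
structures. -/
def IsVelocity {n : ℕ} (c : ℝ → CompatibleStructure X n) (δ : Variation X n) : Prop :=
  (∀ k, ∀ e : atlas ℂ X,
    ContDiffOn ℝ ∞ (fun q : ℝ × ℂ => (c q.1).1 k e q.2) (univ ×ˢ e.1.target)) ∧
  ∀ k, ∀ e : atlas ℂ X, ∀ z ∈ e.1.target, HasDerivAt (fun s => (c s).1 k e z) (δ.1 k e z) 0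

variable [T2Space X] [CompactSpace X]

/-- The cotangent space of the geometric Hitchin space at the class of `μ`. The tangent space
there is the space of all variations `(δμ₂, …, δμ_n)` modulo the variations given by higher vector
fields; its dual, with respect to the integration pairing, consists of the tuples `(t₂, …, t_n)`
that annihilate all variations given by higher vector fields. -/
def cotangentSpace {n : ℕ} (μ : CompatibleStructure X n) : Set (Covector X n) :=
  {t | ∀ (H : RealCotangent X → ℝ) (δ : Variation X n),
    IsHigherHamiltonian H → IsHamiltonianVariation μ H δ → pairing t δ = 0}

/-- The action of higher diffeomorphisms on pairs `(μ, t)`: a higher diffeomorphism `φ` carries `μ`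
to `μ'`, and the covector `t` at `μ` is the pull-back of the covector `t'` at `μ'` under the action
of `φ` on `n`-complex structures. -/
def CovectorRel {n : ℕ} (q q' : CompatibleStructure X n × Covector X n) : Prop :=
  ∃ φ, IsHigherDiffeo φ ∧ Carries φ q.1 q'.1 ∧
    ∀ (c c' : ℝ → CompatibleStructure X n) (δ δ' : Variation X n),
      c 0 = q.1 → c' 0 = q'.1 → (∀ s, Carries φ (c s) (c' s)) →
      IsVelocity c δ → IsVelocity c' δ' → pairing q.2 δ = pairing q'.2 δ'

/-- The quotient of a set of pairs `(μ, t)` by the higher diffeomorphisms. -/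
def ModHigherDiffeos {n : ℕ} (S : Set (CompatibleStructure X n × Covector X n)) : Type _ :=
  Quot fun q q' : S => CovectorRel q.1 q'.1

/-- The class of a pair `(μ, t)`. -/
def ModHigherDiffeos.mk {n : ℕ} {S : Set (CompatibleStructure X n × Covector X n)} (q : S) :
    ModHigherDiffeos S :=
  Quot.mk _ q

/-- The projection to the geometric Hitchin space, `[(μ, t)] ↦ [μ]`. -/
def ModHigherDiffeos.proj {n : ℕ} {S : Set (CompatibleStructure X n × Covector X n)} :
    ModHigherDiffeos S → GeometricHitchinSpace X n :=
  Quot.map (fun q => q.1.1) fun _ _ ⟨φ, h, hc, _⟩ => ⟨φ, h, hc⟩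

variable (X) in
/-- The pairs of a compatible `n`-complex structure `μ` and a cotangent vector `t` at the class
of `μ`. -/
def cotangentPairs (n : ℕ) : Set (CompatibleStructure X n × Covector X n) :=
  {q | q.2 ∈ cotangentSpace q.1}

variable (X) in
/-- The cotangent bundle of the geometric Hitchin space. -/
def HitchinCotangentBundle (n : ℕ) : Type _ := ModHigherDiffeos (cotangentPairs X n)

variable (X) in
/-- The pairs `(μ, t)` with `(-∂̄ + μ₂∂ + k∂μ₂) t_k
+ ∑_{l=1}^{n-k} ((l+k)∂μ_{l+2} + (l+1)μ_{l+2}∂) t_{k+l} = 0` for `k = 2, …, n`. -/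
def solutionPairs (n : ℕ) : Set (CompatibleStructure X n × Covector X n) :=
  {q | ∀ k ∈ Finset.Icc 2 n, ∀ e : atlas ℂ X, ∀ z ∈ e.1.target,
    (-dzbar (q.2.1 k e) z + q.1.1 2 e z * dz (q.2.1 k e) z + k * dz (q.1.1 2 e) z * q.2.1 k e z)
      + ∑ l ∈ Finset.Icc 1 (n - k),
        (((l : ℂ) + k) * dz (q.1.1 (l + 2) e) z * q.2.1 (k + l) e z
          + ((l : ℂ) + 1) * q.1.1 (l + 2) e z * dz (q.2.1 (k + l) e) z) = 0}

end Surface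

end HigherComplex

end

open HigherComplex

/-!
Let `M(p) = μ₂ p + ⋯ + μ_n p^{n-1}`. The substitution `p̄ = M(p)` identifies `ℂ[p, p̄] / I(z)` with
`ℂ[p] / pⁿ` (`mem_span_iff_X_pow_dvd`), so a Hamiltonian `H` vanishing on the zero section reduces
to a polynomial `w₁ p + ⋯ + w_{n-1} p^{n-1}`. The coefficients `w_j` are global sections of `K^{-j}`
(`isSection_hamCoeff`). By the chain rule for the reduction, the bracket `{H, -p̄ + M}` reduces to
`W' ∂M - ∂W M' + ∂̄W` with `W = ∑ w_j p^j`: the terms containing `∂H/∂p̄` cancel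
(`coeff_subst_poisson`). Hence the variation induced by `H` is
`δμ_m = ∂̄w_{m-1} + ∑_{l=2}^m (k w_k ∂μ_l - (l-1) μ_l ∂w_k)` with `k = m + 1 - l`
(`isHamiltonianVariation_iff`).

Integrating by parts on the closed surface moves the derivatives from the `w_k` to the `t_m` and
gives `∫ ∑ t_m δμ_m = ∫ ∑_k w_{k-1} E_k`, where `E_k` is the left-hand side of the `k`-th equation
(`pairing_eq`). The boundary terms `∑ t_m w_{m-1}` and `∑ (l-1) μ_l t_m w_k` are global sections of
`K` and `K̄`, so Stokes' theorem applies to them (`surfaceIntegral_wd_eq_zero`). In particular the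
equations `E_k = 0` imply that `t` is a cotangent vector.

Conversely, the equations follow by descending induction on `k`. Let `s` be a section of
`K^{-(k-1)}` supported in one chart, and test with `H = 2 Re (s p^{k-1})`. Then `w_j = 0` for
`j < k - 1`, while `w_{k-1} = s + m s̄` for a function `m` that depends only on `μ`, and
`E_{k'} = 0` for `k' > k`. So `∫ (s + m s̄) E_k = 0`; taking `s = g` and `s = i g` for a real
bump function `g` eliminates `m` and leaves `∫ g E_k = 0`, whence `E_k = 0`. At `μ = 0` the
equations are the Cauchy-Riemann equations `∂̄t_k = 0`.
-/

namespace HigherComplex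

noncomputable section

open Filter Topology Polynomial

/-! ### Wirtinger operators -/

section Wirtinger

variable {E : Type*} [NormedAddCommGroup E] [NormedSpace ℝ E]

/-- The operator `½ (∂_v + c ∂_w)`. With `E = ℂ`, `v = 1`, `w = i` it is `∂` for `c = -i` and `∂̄`
for `c = i`; with `E = ℂ × ℂ` it gives the partial Wirtinger derivatives. -/
def wd (v w : E) (c : ℂ) (F : E → ℂ) (x : E) : ℂ :=
  (1 / 2) * (fderiv ℝ F x v + c * fderiv ℝ F x w)

theorem dz_eq_wd : dz = wd (1 : ℂ) Complex.I (-Complex.I) := by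
  funext g z
  simp [dz, wd, sub_eq_add_neg]

theorem dzbar_eq_wd : dzbar = wd (1 : ℂ) Complex.I Complex.I := rfl

variable {v w v' w' : E} {c c' : ℂ} {F G : E → ℂ} {x : E} {S : Set E}

theorem wd_congr (h : F =ᶠ[𝓝 x] G) : wd v w c F x = wd v w c G x := by
  simp [wd, h.fderiv_eq]

@[simp] theorem wd_const (a : ℂ) : wd v w c (fun _ : E => a) x = 0 := by
  simp [wd]

theorem wd_add (hF : DifferentiableAt ℝ F x) (hG : DifferentiableAt ℝ G x) :
    wd v w c (fun y => F y + G y) x = wd v w c F x + wd v w c G x := by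
  simp only [wd, fderiv_fun_add hF hG, add_apply]
  ring

theorem wd_mul (hF : DifferentiableAt ℝ F x) (hG : DifferentiableAt ℝ G x) :
    wd v w c (fun y => F y * G y) x = F x * wd v w c G x + G x * wd v w c F x := by
  simp only [wd, fderiv_fun_mul hF hG, add_apply,
    smul_apply, smul_eq_mul]
  ring

theorem wd_const_mul (a : ℂ) (hF : DifferentiableAt ℝ F x) :
    wd v w c (fun y => a * F y) x = a * wd v w c F x := by
  rw [wd_mul (differentiableAt_const a) hF]
  simp

theorem wd_sum {ι : Type*} (s : Finset ι) {f : ι → E → ℂ}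
    (h : ∀ i ∈ s, DifferentiableAt ℝ (f i) x) :
    wd v w c (fun y => ∑ i ∈ s, f i y) x = ∑ i ∈ s, wd v w c (f i) x := by
  simp only [wd, fderiv_fun_sum h, sum_apply, Finset.mul_sum,
    ← Finset.sum_add_distrib]

theorem contDiffOn_wd (hS : IsOpen S) (hF : ContDiffOn ℝ ∞ F S) :
    ContDiffOn ℝ ∞ (wd v w c F) S := by
  have h : ContDiffOn ℝ ∞ (fderiv ℝ F) S := hF.fderiv_of_isOpen hS (by simp)
  have h1 : ∀ u : E, ContDiffOn ℝ ∞ (fun y => fderiv ℝ F y u) S := fun u =>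
    h.clm_apply contDiffOn_const
  exact contDiffOn_const.mul ((h1 v).add (contDiffOn_const.mul (h1 w)))

theorem differentiableAt_of_contDiffOn (hS : IsOpen S) (hF : ContDiffOn ℝ ∞ F S) (hx : x ∈ S) :
    DifferentiableAt ℝ F x :=
  (hF.contDiffAt (hS.mem_nhds hx)).differentiableAt (by simp)

theorem fderiv_wd (hS : IsOpen S) (hF : ContDiffOn ℝ ∞ F S) (hx : x ∈ S) (u : E) :
    fderiv ℝ (wd v w c F) x u = (1 / 2) * (fderiv ℝ (fderiv ℝ F) x u v
      + c * fderiv ℝ (fderiv ℝ F) x u w) := by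
  have h : DifferentiableAt ℝ (fderiv ℝ F) x :=
    ((hF.fderiv_of_isOpen hS (m := ∞) (by simp)).contDiffAt
      (hS.mem_nhds hx)).differentiableAt (by simp)
  have h1 : ∀ u : E, DifferentiableAt ℝ (fun y => fderiv ℝ F y u) x := fun u =>
    h.clm_apply (differentiableAt_const u)
  have h2 : ∀ u' : E, fderiv ℝ (fun y => fderiv ℝ F y u') x u = fderiv ℝ (fderiv ℝ F) x u u' := by
    intro u'
    rw [fderiv_clm_apply h (differentiableAt_const u')]
    simp
  have h3 := (((h1 v).hasFDerivAt.fun_add ((h1 w).hasFDerivAt.const_mul c)).const_mul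
    (1 / 2 : ℂ)).fderiv
  change fderiv ℝ (fun y => (1 / 2 : ℂ) * (fderiv ℝ F y v + c * fderiv ℝ F y w)) x u = _
  rw [h3]
  simp [h2, mul_add]

theorem two_le_infty : (2 : WithTop ℕ∞) ≤ ∞ :=
  WithTop.coe_le_coe.2 le_top

/-- Symmetry of second derivatives. -/
theorem wd_comm (hS : IsOpen S) (hF : ContDiffOn ℝ ∞ F S) (hx : x ∈ S) :
    wd v w c (wd v' w' c' F) x = wd v' w' c' (wd v w c F) x := by
  have hsymm : ∀ a b, fderiv ℝ (fderiv ℝ F) x a b = fderiv ℝ (fderiv ℝ F) x b a := fun a b =>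
    ((hF.contDiffAt (hS.mem_nhds hx)).isSymmSndFDerivAt (by simpa using two_le_infty)).eq a b
  conv_lhs => rw [wd, fderiv_wd hS hF hx, fderiv_wd hS hF hx]
  conv_rhs => rw [wd, fderiv_wd hS hF hx, fderiv_wd hS hF hx]
  rw [hsymm v v', hsymm v w', hsymm w v', hsymm w w']
  ring

theorem contDiffOn_wd_iterate (hS : IsOpen S) (hF : ContDiffOn ℝ ∞ F S) (a : ℕ) :
    ContDiffOn ℝ ∞ ((wd v w c)^[a] F) S := by
  induction a with
  | zero => exact hF
  | succ a ih => rw [Function.iterate_succ_apply']; exact contDiffOn_wd hS ih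

theorem wd_iterate_congr (hS : IsOpen S) (h : EqOn F G S) (a : ℕ) :
    EqOn ((wd v w c)^[a] F) ((wd v w c)^[a] G) S := by
  induction a with
  | zero => exact h
  | succ a ih =>
    intro x hx
    rw [Function.iterate_succ_apply', Function.iterate_succ_apply']
    exact wd_congr (ih.eventuallyEq_of_mem (hS.mem_nhds hx))

theorem wd_iterate_comm (hS : IsOpen S) (hF : ContDiffOn ℝ ∞ F S) (a : ℕ) :
    EqOn ((wd v w c)^[a] (wd v' w' c' F)) (wd v' w' c' ((wd v w c)^[a] F)) S := by
  induction a with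
  | zero => exact fun x _ => rfl
  | succ a ih =>
    intro x hx
    rw [Function.iterate_succ_apply', Function.iterate_succ_apply',
      ← wd_comm hS (contDiffOn_wd_iterate hS hF a) hx]
    exact wd_congr (ih.eventuallyEq_of_mem (hS.mem_nhds hx))

end Wirtinger

/-! ### Partial derivatives of functions of two complex variables -/

theorem wd_slice_right {F : ℂ × ℂ → ℂ} {z p : ℂ} (c : ℂ) (hF : DifferentiableAt ℝ F (z, p)) :
    wd (1 : ℂ) Complex.I c (fun p' => F (z, p')) p
      = wd ((0, 1) : ℂ × ℂ) (0, Complex.I) c F (z, p) := by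
  have h : HasFDerivAt (fun p' : ℂ => F (z, p'))
      ((fderiv ℝ F (z, p)).comp (ContinuousLinearMap.inr ℝ ℂ ℂ)) p :=
    hF.hasFDerivAt.comp p (hasFDerivAt_prodMk_right z p)
  simp [wd, h.fderiv]

theorem wd_slice_left {F : ℂ × ℂ → ℂ} {z p : ℂ} (c : ℂ) (hF : DifferentiableAt ℝ F (z, p)) :
    wd (1 : ℂ) Complex.I c (fun z' => F (z', p)) z
      = wd ((1, 0) : ℂ × ℂ) (Complex.I, 0) c F (z, p) := by
  have h : HasFDerivAt (fun z' : ℂ => F (z', p))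
      ((fderiv ℝ F (z, p)).comp (ContinuousLinearMap.inl ℝ ℂ ℂ)) z :=
    hF.hasFDerivAt.comp z (hasFDerivAt_prodMk_left z p)
  simp [wd, h.fderiv]

theorem wd_slice_right_iterate {F : ℂ × ℂ → ℂ} {U : Set ℂ} (hU : IsOpen U) (c : ℂ)
    (hF : ContDiffOn ℝ ∞ F (U ×ˢ univ)) {z : ℂ} (hz : z ∈ U) (a : ℕ) :
    (wd (1 : ℂ) Complex.I c)^[a] (fun p => F (z, p))
      = fun p => ((wd ((0, 1) : ℂ × ℂ) (0, Complex.I) c)^[a] F) (z, p) := by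
  induction a with
  | zero => rfl
  | succ a ih =>
    funext p
    rw [Function.iterate_succ_apply', Function.iterate_succ_apply', ih]
    exact wd_slice_right c (differentiableAt_of_contDiffOn (hU.prod isOpen_univ)
      (contDiffOn_wd_iterate (hU.prod isOpen_univ) hF a) ⟨hz, mem_univ p⟩)

/-- A holomorphic function satisfies `∂f = f'` and `∂̄f = 0`. -/
theorem dz_of_holomorphic {f : ℂ → ℂ} {z : ℂ} (hf : DifferentiableAt ℂ f z) :
    dz f z = deriv f z ∧ dzbar f z = 0 := by
  have h : HasFDerivAt f
      ((ContinuousLinearMap.toSpanSingleton ℂ (deriv f z)).restrictScalars ℝ) z :=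
    hf.hasDerivAt.hasFDerivAt.restrictScalars ℝ
  have e1 : fderiv ℝ f z 1 = deriv f z := by simp [h.fderiv]
  have e2 : fderiv ℝ f z Complex.I = Complex.I * deriv f z := by simp [h.fderiv]
  have hI := Complex.I_mul_I
  constructor
  · rw [dz, e1, e2]; linear_combination (-(1 / 2) * deriv f z) * hI
  · rw [dzbar, e1, e2]; linear_combination ((1 / 2) * deriv f z) * hI

/-! ### Taylor coefficients along the fibre -/

/-- The Taylor coefficient of `p^a p̄^b` of a function `g` of `p` at `0`. -/
def jet (a b : ℕ) (g : ℂ → ℂ) : ℂ :=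
  (dz^[a] (dzbar^[b] g)) 0 / ((a.factorial : ℂ) * (b.factorial : ℂ))

section Jet

variable {g h : ℂ → ℂ}

theorem contDiff_wd {v w c : ℂ} (hg : ContDiff ℝ ∞ g) : ContDiff ℝ ∞ (wd v w c g) :=
  contDiffOn_univ.1 (contDiffOn_wd isOpen_univ hg.contDiffOn)

theorem contDiff_wd_iterate {v w c : ℂ} (hg : ContDiff ℝ ∞ g) (a : ℕ) :
    ContDiff ℝ ∞ ((wd v w c)^[a] g) :=
  contDiffOn_univ.1 (contDiffOn_wd_iterate isOpen_univ hg.contDiffOn a)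

theorem contDiff_dz (hg : ContDiff ℝ ∞ g) : ContDiff ℝ ∞ (dz g) := by
  rw [dz_eq_wd]; exact contDiff_wd hg

theorem contDiff_dzbar (hg : ContDiff ℝ ∞ g) : ContDiff ℝ ∞ (dzbar g) := by
  rw [dzbar_eq_wd]; exact contDiff_wd hg

theorem jet_dzbar (a b : ℕ) : jet a b (dzbar g) = (b + 1) * jet a (b + 1) g := by
  have : ((b : ℂ) + 1) ≠ 0 := Nat.cast_add_one_ne_zero b
  have h1 : (a.factorial : ℂ) ≠ 0 := Nat.cast_ne_zero.2 a.factorial_ne_zero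
  have h2 : (b.factorial : ℂ) ≠ 0 := Nat.cast_ne_zero.2 b.factorial_ne_zero
  rw [jet, jet, Function.iterate_succ_apply, Nat.factorial_succ]
  push_cast
  field_simp

theorem jet_dz (hg : ContDiff ℝ ∞ g) (a b : ℕ) : jet a b (dz g) = (a + 1) * jet (a + 1) b g := by
  have : ((a : ℂ) + 1) ≠ 0 := Nat.cast_add_one_ne_zero a
  have h1 : (a.factorial : ℂ) ≠ 0 := Nat.cast_ne_zero.2 a.factorial_ne_zero
  have h2 : (b.factorial : ℂ) ≠ 0 := Nat.cast_ne_zero.2 b.factorial_ne_zero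
  have h3 : dzbar^[b] (dz g) = dz (dzbar^[b] g) := by
    rw [dz_eq_wd, dzbar_eq_wd]
    exact funext fun x => wd_iterate_comm isOpen_univ hg.contDiffOn b (mem_univ x)
  rw [jet, jet, h3, Function.iterate_succ_apply, Nat.factorial_succ]
  push_cast
  field_simp

theorem wd_iterate_add {v w c : ℂ} (hg : ContDiff ℝ ∞ g) (hh : ContDiff ℝ ∞ h) (a : ℕ) :
    (wd v w c)^[a] (fun p => g p + h p)
      = fun p => (wd v w c)^[a] g p + (wd v w c)^[a] h p := by
  induction a with
  | zero => rfl
  | succ a ih =>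
    funext p
    rw [Function.iterate_succ_apply', ih, Function.iterate_succ_apply',
      Function.iterate_succ_apply']
    exact wd_add ((contDiff_wd_iterate hg a).differentiable (by simp) p)
      ((contDiff_wd_iterate hh a).differentiable (by simp) p)

theorem wd_iterate_const_mul {v w c : ℂ} (hg : ContDiff ℝ ∞ g) (r : ℂ) (a : ℕ) :
    (wd v w c)^[a] (fun p => r * g p) = fun p => r * (wd v w c)^[a] g p := by
  induction a with
  | zero => rfl
  | succ a ih =>
    funext p
    rw [Function.iterate_succ_apply', ih, Function.iterate_succ_apply']
    exact wd_const_mul r ((contDiff_wd_iterate hg a).differentiable (by simp) p)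

theorem jet_add (hg : ContDiff ℝ ∞ g) (hh : ContDiff ℝ ∞ h) (a b : ℕ) :
    jet a b (fun p => g p + h p) = jet a b g + jet a b h := by
  simp only [jet, dz_eq_wd, dzbar_eq_wd]
  rw [wd_iterate_add hg hh, wd_iterate_add (contDiff_wd_iterate hg b) (contDiff_wd_iterate hh b),
    add_div]

theorem jet_const_mul (hg : ContDiff ℝ ∞ g) (r : ℂ) (a b : ℕ) :
    jet a b (fun p => r * g p) = r * jet a b g := by
  simp only [jet, dz_eq_wd, dzbar_eq_wd]
  rw [wd_iterate_const_mul hg, wd_iterate_const_mul (contDiff_wd_iterate hg b), mul_div_assoc]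

theorem dzbar_iterate_id_mul (hg : ContDiff ℝ ∞ g) (b : ℕ) :
    dzbar^[b] (fun p => p * g p) = fun p => p * dzbar^[b] g p := by
  induction b with
  | zero => rfl
  | succ b ih =>
    funext p
    have h1 := ((dz_of_holomorphic (f := fun p => p) (z := p) differentiableAt_id)).2
    rw [Function.iterate_succ_apply', ih, Function.iterate_succ_apply']
    rw [dzbar_eq_wd] at h1 ⊢
    rw [wd_mul differentiableAt_fun_id ((contDiff_wd_iterate hg b).differentiable (by simp) p), h1]
    simp

theorem dz_iterate_id_mul (hg : ContDiff ℝ ∞ g) (a : ℕ) :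
    dz^[a + 1] (fun p => p * g p)
      = fun p => p * dz^[a + 1] g p + (a + 1) * dz^[a] g p := by
  have h1 : ∀ p, dz (fun p => p) p = 1 := fun p => by
    rw [(dz_of_holomorphic (f := fun p => p) (z := p) differentiableAt_id).1]
    exact (hasDerivAt_id' p).deriv
  have hd : ∀ (k : ℕ) (p : ℂ), DifferentiableAt ℝ (dz^[k] g) p := fun k p => by
    rw [dz_eq_wd]; exact (contDiff_wd_iterate hg k).differentiable (by simp) p
  have hmul : ∀ (k : ℕ) (p : ℂ), dz (fun p => p * dz^[k] g p) p
      = p * dz^[k + 1] g p + dz^[k] g p := fun k p => by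
    have := wd_mul (v := 1) (w := Complex.I) (c := -Complex.I)
      differentiableAt_fun_id (hd k p)
    rw [← dz_eq_wd] at this
    simp only [h1, mul_one] at this
    rw [this, Function.iterate_succ_apply']
  induction a with
  | zero =>
    funext p
    simpa using hmul 0 p
  | succ a ih =>
    funext p
    rw [Function.iterate_succ_apply', ih]
    have h2 := wd_add (v := 1) (w := Complex.I) (c := -Complex.I)
      (differentiableAt_fun_id.fun_mul (hd (a + 1) p)) ((hd a p).const_mul ((a : ℂ) + 1))
    rw [wd_const_mul _ (hd a p), ← dz_eq_wd] at h2
    have h3 := hmul (a + 1) p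
    rw [h2]
    rw [h3, ← Function.iterate_succ_apply' dz a]
    push_cast
    ring

theorem jet_zero_id_mul (hg : ContDiff ℝ ∞ g) (b : ℕ) : jet 0 b (fun p => p * g p) = 0 := by
  simp [jet, dzbar_iterate_id_mul hg]

theorem jet_succ_id_mul (hg : ContDiff ℝ ∞ g) (a b : ℕ) :
    jet (a + 1) b (fun p => p * g p) = jet a b g := by
  have hb : ContDiff ℝ ∞ (dzbar^[b] g) := by
    rw [dzbar_eq_wd]; exact contDiff_wd_iterate hg b
  have : ((a : ℂ) + 1) ≠ 0 := Nat.cast_add_one_ne_zero a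
  have h1 : (a.factorial : ℂ) ≠ 0 := Nat.cast_ne_zero.2 a.factorial_ne_zero
  have h2 : (b.factorial : ℂ) ≠ 0 := Nat.cast_ne_zero.2 b.factorial_ne_zero
  rw [jet, jet, dzbar_iterate_id_mul hg, dz_iterate_id_mul hb, Nat.factorial_succ]
  push_cast
  field_simp
  simp

end Jet

/-! ### Reduction of Taylor expansions modulo the ideal -/

/-- The reduction of the Taylor expansion of `g` modulo `p̄ = M(p)`, as a polynomial in `p`. The
bidegrees are cut off at `N`, which does not matter modulo `p^N` when `p` divides `M`. -/
def red (N : ℕ) (M : ℂ[X]) (g : ℂ → ℂ) : ℂ[X] :=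
  ∑ a ∈ Finset.range N, ∑ b ∈ Finset.range N, C (jet a b g) * (X ^ a * M ^ b)

section Red

variable {N : ℕ} {M : ℂ[X]} {g h : ℂ → ℂ}

theorem red_add (hg : ContDiff ℝ ∞ g) (hh : ContDiff ℝ ∞ h) :
    red N M (fun p => g p + h p) = red N M g + red N M h := by
  simp only [red, jet_add hg hh, C_add, add_mul, Finset.sum_add_distrib]

theorem red_const_mul (hg : ContDiff ℝ ∞ g) (r : ℂ) :
    red N M (fun p => r * g p) = C r * red N M g := by
  simp only [red, jet_const_mul hg, C_mul, Finset.mul_sum, mul_assoc]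

/-- Multiplication by `p` shifts Taylor coefficients, up to the cut-off. -/
theorem red_id_mul (hg : ContDiff ℝ ∞ g) :
    X ^ N ∣ red N M (fun p => p * g p) - red N M g * X := by
  rcases N with _ | N
  · simp
  have h1 : red (N + 1) M (fun p => p * g p)
      = ∑ a ∈ Finset.range N, ∑ b ∈ Finset.range (N + 1),
          C (jet a b g) * (X ^ (a + 1) * M ^ b) := by
    rw [red, Finset.sum_range_succ']
    simp [jet_zero_id_mul hg, jet_succ_id_mul hg]
  have h2 : red (N + 1) M g * X
      = ∑ a ∈ Finset.range (N + 1), ∑ b ∈ Finset.range (N + 1),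
          C (jet a b g) * (X ^ (a + 1) * M ^ b) := by
    rw [red]
    simp only [Finset.sum_mul]
    refine Finset.sum_congr rfl fun a _ => Finset.sum_congr rfl fun b _ => ?_
    ring
  rw [h1, h2, Finset.sum_range_succ, sub_add_cancel_left, dvd_neg]
  exact Finset.dvd_sum fun b _ => ((dvd_mul_right _ _).mul_left _)

theorem red_mul_pow (hg : ContDiff ℝ ∞ g) (k : ℕ) :
    X ^ N ∣ red N M (fun p => g p * p ^ k) - red N M g * X ^ k := by
  induction k with
  | zero => simp
  | succ k ih =>
    have hs : ContDiff ℝ ∞ (fun p => g p * p ^ k) := by fun_prop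
    have h1 := red_id_mul (N := N) (M := M) hs
    have h2 := ih.mul_right (X : ℂ[X])
    have h3 := dvd_add h1 h2
    have e : (fun p : ℂ => p * (g p * p ^ k)) = fun p => g p * p ^ (k + 1) := by
      funext p; ring
    rw [e] at h3
    convert h3 using 1
    ring

theorem red_mul_eval (hg : ContDiff ℝ ∞ g) (Q : ℂ[X]) :
    X ^ N ∣ red N M (fun p => g p * Q.eval p) - red N M g * Q := by
  have hsm : ∀ P : ℂ[X], ContDiff ℝ ∞ (fun p => g p * P.eval p) := fun P =>
    by
    have := (P.contDiff_aeval (𝕜 := ℂ) ∞).restrict_scalars ℝ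
    simp only [coe_aeval_eq_eval] at this
    exact hg.mul this
  induction Q using Polynomial.induction_on' with
  | add P Q hP hQ =>
    have e : (fun p => g p * (P + Q).eval p) = fun p => g p * P.eval p + g p * Q.eval p := by
      funext p; rw [eval_add]; ring
    rw [e, red_add (hsm P) (hsm Q)]
    convert dvd_add hP hQ using 1
    ring
  | monomial k r =>
    have hs : ContDiff ℝ ∞ (fun p => g p * p ^ k) := by fun_prop
    have e : (fun p => g p * (monomial k r).eval p) = fun p => r * (g p * p ^ k) := by
      funext p; rw [eval_monomial]; ring
    rw [e, red_const_mul hs, ← C_mul_X_pow_eq_monomial]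
    convert (red_mul_pow (N := N) (M := M) hg k).mul_left (C r) using 1
    ring

/-- The chain rule for the derivative in `p` of the reduction. The cut-off is `N + 1` because
differentiation loses one order in `p`. -/
theorem derivative_red (hg : ContDiff ℝ ∞ g) (hM : X ∣ M) (N : ℕ) :
    X ^ N ∣ derivative (red (N + 1) M g)
      - (red (N + 1) M (dz g) + red (N + 1) M (dzbar g) * derivative M) := by
  have h1 : derivative (red (N + 1) M g)
      = (∑ b ∈ Finset.range (N + 1), ∑ a ∈ Finset.range (N + 1),
          C (jet a b g) * (C (a : ℂ) * X ^ (a - 1) * M ^ b))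
        + (∑ a ∈ Finset.range (N + 1), ∑ b ∈ Finset.range (N + 1),
          C (jet a b g) * (X ^ a * (C (b : ℂ) * M ^ (b - 1)))) * derivative M := by
    rw [Finset.sum_comm, red]
    simp only [Finset.sum_mul]
    rw [← Finset.sum_add_distrib, derivative_sum]
    refine Finset.sum_congr rfl fun a _ => ?_
    rw [← Finset.sum_add_distrib, derivative_sum]
    refine Finset.sum_congr rfl fun b _ => ?_
    rw [derivative_C_mul, derivative_mul, derivative_pow, derivative_pow, derivative_X]
    ring
  have h2 : ∀ b, ∑ a ∈ Finset.range (N + 1), C (jet a b g) * (C (a : ℂ) * X ^ (a - 1) * M ^ b)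
      = ∑ a ∈ Finset.range N, C (jet a b (dz g)) * (X ^ a * M ^ b) := fun b => by
    rw [Finset.sum_range_succ']
    simp only [Nat.cast_zero, C_0, zero_mul, mul_zero, add_zero]
    refine Finset.sum_congr rfl fun a _ => ?_
    rw [jet_dz hg, Nat.add_sub_cancel, C_mul]
    push_cast
    ring
  have h3 : ∀ a, ∑ b ∈ Finset.range (N + 1), C (jet a b g) * (X ^ a * (C (b : ℂ) * M ^ (b - 1)))
      = ∑ b ∈ Finset.range N, C (jet a b (dzbar g)) * (X ^ a * M ^ b) := fun a => by
    rw [Finset.sum_range_succ']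
    simp only [Nat.cast_zero, C_0, zero_mul, mul_zero, add_zero]
    refine Finset.sum_congr rfl fun b _ => ?_
    rw [jet_dzbar, Nat.add_sub_cancel, C_mul]
    push_cast
    ring
  have h4 : red (N + 1) M (dz g)
      = (∑ b ∈ Finset.range (N + 1), ∑ a ∈ Finset.range N, C (jet a b (dz g)) * (X ^ a * M ^ b))
        + ∑ b ∈ Finset.range (N + 1), C (jet N b (dz g)) * (X ^ N * M ^ b) := by
    rw [red, Finset.sum_comm, ← Finset.sum_add_distrib]
    exact Finset.sum_congr rfl fun b _ => Finset.sum_range_succ _ _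
  have h5 : red (N + 1) M (dzbar g)
      = (∑ a ∈ Finset.range (N + 1), ∑ b ∈ Finset.range N, C (jet a b (dzbar g)) * (X ^ a * M ^ b))
        + ∑ a ∈ Finset.range (N + 1), C (jet a N (dzbar g)) * (X ^ a * M ^ N) := by
    rw [red, ← Finset.sum_add_distrib]
    exact Finset.sum_congr rfl fun b _ => Finset.sum_range_succ _ _
  rw [h1, h4, h5]
  simp only [h2, h3]
  have h6 : X ^ N ∣ ∑ b ∈ Finset.range (N + 1), C (jet N b (dz g)) * (X ^ N * M ^ b) :=
    Finset.dvd_sum fun b _ => ((dvd_mul_right _ _).mul_left _)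
  have h7 : X ^ N ∣ ∑ a ∈ Finset.range (N + 1), C (jet a N (dzbar g)) * (X ^ a * M ^ N) :=
    Finset.dvd_sum fun b _ => (((pow_dvd_pow_of_dvd hM N).mul_left _).mul_left _)
  convert dvd_neg.2 (dvd_add h6 (h7.mul_right (derivative M))) using 1
  ring

end Red

/-! ### Coefficientwise derivatives of families of polynomials -/

/-- `P'` is the coefficientwise derivative at `z` of the family `P` of polynomials, for the
Wirtinger operator with parameter `c`. -/
def HasWd (c : ℂ) (P : ℂ → ℂ[X]) (P' : ℂ[X]) (z : ℂ) : Prop :=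
  ∀ j, DifferentiableAt ℝ (fun z => (P z).coeff j) z ∧
    wd 1 Complex.I c (fun z => (P z).coeff j) z = P'.coeff j

section HasWd

variable {c z : ℂ} {P Q : ℂ → ℂ[X]} {P' Q' : ℂ[X]}

theorem HasWd.const (P : ℂ[X]) : HasWd c (fun _ => P) 0 z := fun j => by
  simp

theorem HasWd.sum {ι : Type*} (s : Finset ι) {P : ι → ℂ → ℂ[X]} {P' : ι → ℂ[X]}
    (h : ∀ i ∈ s, HasWd c (P i) (P' i) z) :
    HasWd c (fun z => ∑ i ∈ s, P i z) (∑ i ∈ s, P' i) z := fun j => by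
  simp only [finsetSum_coeff]
  refine ⟨DifferentiableAt.fun_sum fun i hi => (h i hi j).1, ?_⟩
  rw [wd_sum s fun i hi => (h i hi j).1]
  exact Finset.sum_congr rfl fun i hi => (h i hi j).2

theorem HasWd.mul (hP : HasWd c P P' z) (hQ : HasWd c Q Q' z) :
    HasWd c (fun z => P z * Q z) (P' * Q z + P z * Q') z := fun j => by
  simp only [coeff_add, coeff_mul]
  have hd : ∀ x ∈ Finset.HasAntidiagonal.antidiagonal j,
      DifferentiableAt ℝ (fun z => (P z).coeff x.1 * (Q z).coeff x.2) z := fun x _ =>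
    (hP x.1).1.mul (hQ x.2).1
  refine ⟨DifferentiableAt.fun_sum hd, ?_⟩
  rw [wd_sum _ hd, ← Finset.sum_add_distrib]
  refine Finset.sum_congr rfl fun x _ => ?_
  rw [wd_mul (hP x.1).1 (hQ x.2).1, (hP x.1).2, (hQ x.2).2]
  ring

theorem HasWd.pow (hP : HasWd c P P' z) (k : ℕ) :
    HasWd c (fun z => P z ^ k) (C (k : ℂ) * P z ^ (k - 1) * P') z := by
  induction k with
  | zero => simpa using HasWd.const 1
  | succ k ih =>
    have := ih.mul hP
    simp only [← pow_succ] at this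
    convert this using 1
    rcases k with _ | k
    · simp
    · simp only [Nat.add_sub_cancel, pow_succ]
      rw [Nat.cast_succ, C_add, C_1]
      ring

theorem HasWd.C {f : ℂ → ℂ} (hf : DifferentiableAt ℝ f z) :
    HasWd c (fun z => C (f z)) (C (wd 1 Complex.I c f z)) z := fun j => by
  simp only [coeff_C]
  split_ifs <;> simp [hf]

end HasWd

/-! ### The ideal of an `n`-complex structure -/

theorem coeff_eq_of_X_pow_dvd {n : ℕ} {P Q : ℂ[X]} (h : X ^ n ∣ P - Q) {j : ℕ} (hj : j < n) :
    P.coeff j = Q.coeff j := by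
  have := X_pow_dvd_iff.1 h j hj
  rwa [coeff_sub, sub_eq_zero] at this

/-- The substitution `p̄ = M(p)`. -/
def subst (M : ℂ[X]) : MvPolynomial (Fin 2) ℂ →ₐ[ℂ] ℂ[X] :=
  MvPolynomial.aeval ![X, M]

@[simp] theorem subst_X_zero (M : ℂ[X]) : subst M (MvPolynomial.X 0) = X := by simp [subst]

@[simp] theorem subst_X_one (M : ℂ[X]) : subst M (MvPolynomial.X 1) = M := by simp [subst]

@[simp] theorem subst_C (M : ℂ[X]) (r : ℂ) : subst M (MvPolynomial.C r) = C r := by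
  simp [subst]

/-- The substitution `p̄ = M(p)` identifies the quotient by `⟨pⁿ, -p̄ + M(p)⟩` with
`ℂ[p] / pⁿ`. -/
theorem mem_span_iff_X_pow_dvd (n : ℕ) (M : MvPolynomial (Fin 2) ℂ) (M' : ℂ[X])
    (hM : aeval (MvPolynomial.X 0) M' = M) (P : MvPolynomial (Fin 2) ℂ) :
    P ∈ Ideal.span {MvPolynomial.X 0 ^ n, -MvPolynomial.X 1 + M} ↔ X ^ n ∣ subst M' P := by
  have hsub : ∀ Q : ℂ[X], subst M' (aeval (MvPolynomial.X 0) Q) = Q := fun Q => by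
    rw [← aeval_algHom_apply]; simp
  constructor
  · intro h
    obtain ⟨a, b, rfl⟩ := Ideal.mem_span_pair.1 h
    simp [← hM, hsub]
  · rintro ⟨Q, hQ⟩
    have key : ∀ P : MvPolynomial (Fin 2) ℂ,
        P - aeval (MvPolynomial.X 0) (subst M' P) ∈
          Ideal.span {(MvPolynomial.X 0 : MvPolynomial (Fin 2) ℂ) ^ n, -MvPolynomial.X 1 + M} := by
      intro P
      rw [← Ideal.Quotient.eq]
      induction P using MvPolynomial.induction_on with
      | C r =>
        rw [subst_C, aeval_C]; rfl
      | add P Q hP hQ => simp only [map_add, hP, hQ]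
      | mul_X P i hP =>
        simp only [map_mul]
        rw [hP]
        congr 1
        fin_cases i
        · simp
        · simp only [Fin.mk_one, subst_X_one]
          rw [hM, Ideal.Quotient.eq]
          have := SetLike.mem_coe.1 (Ideal.subset_span (α := MvPolynomial (Fin 2) ℂ)
            (s := {MvPolynomial.X 0 ^ n, -MvPolynomial.X 1 + M}) (mem_insert_of_mem _ rfl))
          rw [← neg_mem_iff]
          convert this using 1
          ring
    have h1 := key P
    have h2 : aeval (MvPolynomial.X 0) (subst M' P) ∈
        Ideal.span {(MvPolynomial.X 0 : MvPolynomial (Fin 2) ℂ) ^ n, -MvPolynomial.X 1 + M} := by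
      rw [hQ, map_mul, map_pow, aeval_X]
      exact Ideal.mul_mem_right _ _ (Ideal.subset_span (mem_insert _ _))
    simpa using add_mem h1 h2

theorem coeff_X_pow_mul_pow_eq_zero {M : ℂ[X]} (hM : X ∣ M) {a b j : ℕ} (h : j < a + b) :
    (X ^ a * M ^ b).coeff j = 0 := by
  refine X_pow_dvd_iff.1 ?_ j h
  rw [pow_add]
  exact mul_dvd_mul_left _ (pow_dvd_pow_of_dvd hM b)

/-- In degrees below `n`, the reduction of the Taylor polynomial of total degree less than `n`
agrees with `red`, which uses the Taylor coefficients in a box: the terms in which they differ are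
divisible by `pⁿ`. -/
theorem coeff_subst_fibreTaylor {M : ℂ[X]} (hM : X ∣ M) (n : ℕ) (g : ℂ → ℂ) {j : ℕ} (hj : j < n) :
    (subst M (fibreTaylor n g)).coeff j = (red (n + 1) M g).coeff j := by
  have h0 : ∀ a b, n ≤ a + b → (C (jet a b g) * (X ^ a * M ^ b)).coeff j = 0 := fun a b h => by
    rw [coeff_C_mul, coeff_X_pow_mul_pow_eq_zero hM (hj.trans_le h), mul_zero]
  have h1 : subst M (fibreTaylor n g)
      = ∑ a ∈ Finset.range n, ∑ b ∈ Finset.range (n - a), C (jet a b g) * (X ^ a * M ^ b) := by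
    simp [fibreTaylor, jet, mul_assoc]
  rw [h1, red]
  simp only [finsetSum_coeff]
  rw [Finset.sum_range_succ, Finset.sum_eq_zero (s := Finset.range (n + 1))
    fun b _ => h0 n b (by omega), add_zero]
  refine Finset.sum_congr rfl fun a ha => Finset.sum_subset (fun b => ?_) fun b _ hb => h0 a b ?_
  · simp only [Finset.mem_range]; omega
  · simp only [Finset.mem_range] at hb; omega

/-- The polynomial `μ₂ p + ⋯ + μ_n p^{n-1}`, to which `p̄` reduces modulo the ideal. -/
def genPoly (n : ℕ) (m : ℕ → ℂ) : ℂ[X] :=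
  ∑ k ∈ Finset.Icc 2 n, C (m k) * X ^ (k - 1)

theorem X_dvd_genPoly (n : ℕ) (m : ℕ → ℂ) : X ∣ genPoly n m :=
  Finset.dvd_sum fun k hk => (dvd_pow_self X (by
    have := (Finset.mem_Icc.1 hk).1; omega)).mul_left _

theorem coeff_genPoly (n : ℕ) (m : ℕ → ℂ) (j : ℕ) :
    (genPoly n m).coeff j = if j + 1 ∈ Finset.Icc 2 n then m (j + 1) else 0 := by
  simp only [genPoly, finsetSum_coeff, coeff_C_mul, coeff_X_pow]
  rw [← Finset.sum_ite_eq' (Finset.Icc 2 n) (j + 1) m]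
  refine Finset.sum_congr rfl fun k hk => ?_
  have := (Finset.mem_Icc.1 hk).1
  by_cases h : k = j + 1
  · simp [h]
  · rw [if_neg h, if_neg (by omega), mul_zero]

/-! ### The Poisson bracket modulo the ideal -/

section Poisson

variable {U : Set ℂ} {F : ℂ × ℂ → ℂ} {μ : ℕ → ℂ → ℂ} {n : ℕ} {z : ℂ}

/-- The function `w_j(z)`: the coefficient of `p^j` in the reduction of `F(z, ·)` modulo the ideal.
The cut-off `n + 1` leaves the coefficients below `n` unaffected, also after differentiation. -/
def redCoeff (n : ℕ) (μ : ℕ → ℂ → ℂ) (F : ℂ × ℂ → ℂ) (j : ℕ) (z : ℂ) : ℂ :=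
  (red (n + 1) (genPoly n fun k => μ k z) fun p => F (z, p)).coeff j

theorem contDiff_slice (hF : ContDiffOn ℝ ∞ F (U ×ˢ univ)) (hz : z ∈ U) :
    ContDiff ℝ ∞ fun p => F (z, p) := by
  rw [← contDiffOn_univ]
  exact hF.comp (by fun_prop) fun p _ => ⟨hz, mem_univ p⟩

theorem jet_slice (hU : IsOpen U) (hF : ContDiffOn ℝ ∞ F (U ×ˢ univ)) (hz : z ∈ U) (a b : ℕ) :
    jet a b (fun p => F (z, p))
      = (wd ((0, 1) : ℂ × ℂ) (0, Complex.I) (-Complex.I))^[a]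
          ((wd ((0, 1) : ℂ × ℂ) (0, Complex.I) Complex.I)^[b] F) (z, 0)
        / ((a.factorial : ℂ) * (b.factorial : ℂ)) := by
  rw [jet, dz_eq_wd, dzbar_eq_wd, wd_slice_right_iterate hU _ hF hz,
    wd_slice_right_iterate hU _ (contDiffOn_wd_iterate (hU.prod isOpen_univ) hF b) hz]

theorem contDiffOn_jet_slice (hU : IsOpen U) (hF : ContDiffOn ℝ ∞ F (U ×ˢ univ)) (a b : ℕ) :
    ContDiffOn ℝ ∞ (fun z => jet a b fun p => F (z, p)) U := by
  have hS : IsOpen (U ×ˢ (univ : Set ℂ)) := hU.prod isOpen_univ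
  have h1 := contDiffOn_wd_iterate (v := (0, 1)) (w := (0, Complex.I)) (c := -Complex.I) hS
    (contDiffOn_wd_iterate (v := (0, 1)) (w := (0, Complex.I)) (c := Complex.I) hS hF b) a
  have h2 : ContDiffOn ℝ ∞ (fun z : ℂ => (z, (0 : ℂ))) U := by fun_prop
  exact ((h1.comp h2 fun z hz => ⟨hz, mem_univ _⟩).div_const _).congr fun z hz =>
    jet_slice hU hF hz a b

/-- Derivatives along the base commute with taking Taylor coefficients along the fibre. -/
theorem jet_base_wd (hU : IsOpen U) (hF : ContDiffOn ℝ ∞ F (U ×ˢ univ)) (hz : z ∈ U) (c : ℂ)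
    (a b : ℕ) :
    jet a b (fun p => wd ((1, 0) : ℂ × ℂ) (Complex.I, 0) c F (z, p))
      = wd 1 Complex.I c (fun z => jet a b fun p => F (z, p)) z := by
  have hS : IsOpen (U ×ˢ (univ : Set ℂ)) := hU.prod isOpen_univ
  have hb := contDiffOn_wd_iterate (v := (0, 1)) (w := (0, Complex.I)) (c := Complex.I) hS hF b
  have hab := contDiffOn_wd_iterate (v := (0, 1)) (w := (0, Complex.I)) (c := -Complex.I) hS hb a
  have hmem : ((z, 0) : ℂ × ℂ) ∈ U ×ˢ (univ : Set ℂ) := ⟨hz, mem_univ _⟩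
  rw [jet_slice hU (contDiffOn_wd hS hF) hz,
    wd_iterate_congr hS (wd_iterate_comm hS hF b) a hmem, wd_iterate_comm hS hb a hmem,
    ← wd_slice_left c (differentiableAt_of_contDiffOn hS hab hmem)]
  have h1 : DifferentiableAt ℝ (fun z' => (wd ((0, 1) : ℂ × ℂ) (0, Complex.I) (-Complex.I))^[a]
      ((wd ((0, 1) : ℂ × ℂ) (0, Complex.I) Complex.I)^[b] F) (z', 0)) z :=
    (differentiableAt_of_contDiffOn hS hab hmem).comp (f := fun z' : ℂ => (z', (0 : ℂ))) z
      (by fun_prop)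
  rw [div_eq_inv_mul, ← wd_const_mul _ h1]
  refine wd_congr ?_
  filter_upwards [hU.mem_nhds hz] with z' hz'
  rw [jet_slice hU hF hz', div_eq_inv_mul]

theorem hasWd_genPoly (hU : IsOpen U) (hμ : ∀ k, ContDiffOn ℝ ∞ (μ k) U) (hz : z ∈ U) (c : ℂ) :
    HasWd c (fun z => genPoly n fun k => μ k z)
      (genPoly n fun k => wd 1 Complex.I c (μ k) z) z := by
  refine HasWd.sum _ fun k _ => ?_
  simpa using (HasWd.C (differentiableAt_of_contDiffOn hU (hμ k) hz)).mul
    (HasWd.const (X ^ (k - 1)))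

/-- The chain rule for base derivatives of the reduction. -/
theorem wd_redCoeff (hU : IsOpen U) (hμ : ∀ k, ContDiffOn ℝ ∞ (μ k) U)
    (hF : ContDiffOn ℝ ∞ F (U ×ˢ univ)) (hz : z ∈ U) (c : ℂ) {j : ℕ} (hj : j < n) :
    wd 1 Complex.I c (redCoeff n μ F j) z
      = (red (n + 1) (genPoly n fun k => μ k z)
            (fun p => wd ((1, 0) : ℂ × ℂ) (Complex.I, 0) c F (z, p))
          + red (n + 1) (genPoly n fun k => μ k z) (dzbar fun p => F (z, p))
            * genPoly n fun k => wd 1 Complex.I c (μ k) z).coeff j := by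
  set M := genPoly n fun k => μ k z with hM
  set M' := genPoly n fun k => wd 1 Complex.I c (μ k) z with hM'
  have h1 : HasWd c (fun z => red (n + 1) (genPoly n fun k => μ k z) fun p => F (z, p))
      (∑ a ∈ Finset.range (n + 1), ∑ b ∈ Finset.range (n + 1),
        (C (wd 1 Complex.I c (fun z => jet a b fun p => F (z, p)) z) * (X ^ a * M ^ b)
          + C (jet a b fun p => F (z, p)) * (X ^ a * (C (b : ℂ) * M ^ (b - 1) * M')))) z := by
    refine HasWd.sum _ fun a _ => HasWd.sum _ fun b _ => ?_
    have h2 := (HasWd.const (c := c) (z := z) (X ^ a)).mul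
      ((hasWd_genPoly (n := n) hU hμ hz c).pow b)
    have h3 := (HasWd.C (c := c) (differentiableAt_of_contDiffOn hU
      (contDiffOn_jet_slice hU hF a b) hz)).mul h2
    simpa using h3
  rw [show wd 1 Complex.I c (redCoeff n μ F j) z = _ from (h1 j).2]
  refine coeff_eq_of_X_pow_dvd ?_ hj
  have h4 : red (n + 1) M (dzbar fun p => F (z, p))
      = (∑ a ∈ Finset.range (n + 1), ∑ b ∈ Finset.range (n + 1),
          C (jet a b fun p => F (z, p)) * (X ^ a * (C (b : ℂ) * M ^ (b - 1))))
        + ∑ a ∈ Finset.range (n + 1), C (jet a n (dzbar fun p => F (z, p))) * (X ^ a * M ^ n) := by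
    rw [red, ← Finset.sum_add_distrib]
    refine Finset.sum_congr rfl fun a _ => ?_
    rw [Finset.sum_range_succ, Finset.sum_range_succ' (n := n)]
    simp only [Nat.cast_zero, C_0, zero_mul, mul_zero, add_zero]
    congr 1
    refine Finset.sum_congr rfl fun b _ => ?_
    rw [jet_dzbar, Nat.add_sub_cancel, C_mul]
    push_cast
    ring
  have h5 : X ^ n ∣ ∑ a ∈ Finset.range (n + 1),
      C (jet a n (dzbar fun p => F (z, p))) * (X ^ a * M ^ n) :=
    Finset.dvd_sum fun b _ =>
      (((pow_dvd_pow_of_dvd (X_dvd_genPoly n _) n).mul_left _).mul_left _)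
  rw [h4]
  simp only [red, jet_base_wd hU hF hz, Finset.sum_add_distrib, add_mul, Finset.sum_mul]
  convert dvd_neg.2 (h5.mul_right M') using 1
  rw [Finset.sum_mul]
  simp only [mul_assoc]
  abel

theorem redCoeff_zero (z : ℂ) : redCoeff n μ F 0 z = F (z, 0) := by
  have h0 : ∀ a b, a + b ≠ 0 → ∀ r : ℂ,
      (C r * (X ^ a * (genPoly n fun k => μ k z) ^ b)).coeff 0 = 0 := fun a b h r => by
    rw [coeff_C_mul, coeff_X_pow_mul_pow_eq_zero (X_dvd_genPoly n _) (Nat.pos_of_ne_zero h),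
      mul_zero]
  simp only [redCoeff, red, finsetSum_coeff]
  rw [Finset.sum_eq_single 0, Finset.sum_eq_single 0]
  · simp [jet]
  · exact fun b _ hb => h0 0 b (by omega) _
  · simp
  · exact fun a _ ha => Finset.sum_eq_zero fun b _ => h0 a b (by omega) _
  · simp

theorem eval_genPoly (m : ℕ → ℂ) (p : ℂ) :
    (genPoly n m).eval p = ∑ k ∈ Finset.Icc 2 n, m k * p ^ (k - 1) := by
  simp [genPoly, eval_finsetSum]

theorem dz_neg_conj_add_eval (Q : ℂ[X]) (p : ℂ) :
    dz (fun p => -(starRingEnd ℂ p) + Q.eval p) p = (derivative Q).eval p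
      ∧ dzbar (fun p => -(starRingEnd ℂ p) + Q.eval p) p = -1 := by
  have hc : HasFDerivAt (fun p : ℂ => -(starRingEnd ℂ p))
      (-(Complex.conjCLE : ℂ →L[ℝ] ℂ)) p := Complex.conjCLE.hasFDerivAt.neg
  have hq := dz_of_holomorphic (Q.differentiable (x := p))
  have hqd : DifferentiableAt ℝ (fun p => Q.eval p) p :=
    (Q.differentiable (x := p)).restrictScalars ℝ
  have hI := Complex.I_mul_I
  constructor
  · rw [← Polynomial.deriv, ← hq.1, dz_eq_wd, wd_add hc.differentiableAt hqd]
    simp [wd, hc.fderiv]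
  · have := wd_add (v := 1) (w := Complex.I) (c := Complex.I) hc.differentiableAt hqd
    rw [← dzbar_eq_wd, hq.2] at this
    rw [this, dzbar, hc.fderiv]
    simp
    ring

/-- The Poisson bracket with the generator `-p̄ + M` reduces to `W' ∂M - ∂W M' + ∂̄W`, where `W` is
the reduction of `F`. The base derivatives of `W` appear here in the form given by `wd_redCoeff`; the
terms with `∂F/∂p̄` in `W'` and `∂W` cancel each other. -/
theorem red_poisson (hU : IsOpen U) (hμ : ∀ k, ContDiffOn ℝ ∞ (μ k) U)
    (hF : ContDiffOn ℝ ∞ F (U ×ˢ univ)) (hz : z ∈ U) :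
    X ^ n ∣ red (n + 1) (genPoly n fun k => μ k z) (poisson (fun z p => F (z, p))
        (fun z p => -(starRingEnd ℂ p) + ∑ k ∈ Finset.Icc 2 n, μ k z * p ^ (k - 1)) z)
      - (derivative (red (n + 1) (genPoly n fun k => μ k z) fun p => F (z, p))
            * (genPoly n fun k => dz (μ k) z)
          - (red (n + 1) (genPoly n fun k => μ k z)
              (fun p => wd ((1, 0) : ℂ × ℂ) (Complex.I, 0) (-Complex.I) F (z, p))
            + red (n + 1) (genPoly n fun k => μ k z) (dzbar fun p => F (z, p))
              * genPoly n fun k => dz (μ k) z) * derivative (genPoly n fun k => μ k z)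
          + (red (n + 1) (genPoly n fun k => μ k z)
              (fun p => wd ((1, 0) : ℂ × ℂ) (Complex.I, 0) Complex.I F (z, p))
            + red (n + 1) (genPoly n fun k => μ k z) (dzbar fun p => F (z, p))
              * genPoly n fun k => dzbar (μ k) z)) := by
  have hS : IsOpen (U ×ˢ (univ : Set ℂ)) := hU.prod isOpen_univ
  have hf : ContDiff ℝ ∞ fun p => F (z, p) := contDiff_slice hF hz
  have hb : ∀ c, ContDiff ℝ ∞ fun p => wd ((1, 0) : ℂ × ℂ) (Complex.I, 0) c F (z, p) := fun c =>
    contDiff_slice (contDiffOn_wd hS hF) hz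
  have hFd : ∀ p, DifferentiableAt ℝ F (z, p) := fun p =>
    differentiableAt_of_contDiffOn hS hF ⟨hz, mem_univ p⟩
  have hμd : ∀ k, DifferentiableAt ℝ (μ k) z := fun k =>
    differentiableAt_of_contDiffOn hU (hμ k) hz
  set M := genPoly n fun k => μ k z with hM
  set f : ℂ → ℂ := fun p => F (z, p) with hf_def
  have hgen : ∀ c p, wd (1 : ℂ) Complex.I c
      (fun z' => -(starRingEnd ℂ p) + ∑ k ∈ Finset.Icc 2 n, μ k z' * p ^ (k - 1)) z
      = (genPoly n fun k => wd 1 Complex.I c (μ k) z).eval p := fun c p => by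
    have hd : ∀ k, DifferentiableAt ℝ (fun z' => μ k z' * p ^ (k - 1)) z := fun k =>
      (hμd k).mul_const _
    rw [wd_add (differentiableAt_const _) (DifferentiableAt.fun_sum fun k _ => hd k), wd_const,
      zero_add, wd_sum _ fun k _ => hd k, eval_genPoly]
    refine Finset.sum_congr rfl fun k _ => ?_
    rw [wd_mul (hμd k) (differentiableAt_const _), wd_const]
    ring
  have hG : (fun p => -(starRingEnd ℂ p) + ∑ k ∈ Finset.Icc 2 n, μ k z * p ^ (k - 1))
      = fun p => -(starRingEnd ℂ p) + M.eval p := by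
    funext p; rw [hM, eval_genPoly]
  have hpois : poisson (fun z p => F (z, p))
        (fun z p => -(starRingEnd ℂ p) + ∑ k ∈ Finset.Icc 2 n, μ k z * p ^ (k - 1)) z
      = fun p => ((dz f p * (genPoly n fun k => dz (μ k) z).eval p
          + (-1) * (wd ((1, 0) : ℂ × ℂ) (Complex.I, 0) (-Complex.I) F (z, p)
            * (derivative M).eval p))
          + dzbar f p * (genPoly n fun k => dzbar (μ k) z).eval p)
          + wd ((1, 0) : ℂ × ℂ) (Complex.I, 0) Complex.I F (z, p) := by
    funext p
    rw [poisson, hG, (dz_neg_conj_add_eval M p).1, (dz_neg_conj_add_eval M p).2]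
    simp only [dz_eq_wd, dzbar_eq_wd, hgen, ← wd_slice_left _ (hFd p)]
    ring
  have hpoly : ∀ {g : ℂ → ℂ} (_ : ContDiff ℝ ∞ g) (Q : ℂ[X]),
      ContDiff ℝ ∞ fun p => g p * Q.eval p := fun hg Q => by
    have := (Q.contDiff_aeval (𝕜 := ℂ) ∞).restrict_scalars ℝ
    simp only [coe_aeval_eq_eval] at this
    exact hg.mul this
  have s1 := hpoly (contDiff_dz hf) (genPoly n fun k => dz (μ k) z)
  have s2 := hpoly (hb (-Complex.I)) (derivative M)
  have s3 := hpoly (contDiff_dzbar hf) (genPoly n fun k => dzbar (μ k) z)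
  rw [hpois, red_add ((s1.add (contDiff_const.mul s2)).add s3) (hb _),
    red_add (s1.add (contDiff_const.mul s2)) s3, red_add s1 (contDiff_const.mul s2),
    red_const_mul s2]
  have hpow : (X : ℂ[X]) ^ n ∣ X ^ (n + 1) := pow_dvd_pow _ (Nat.le_succ n)
  have e1 := hpow.trans (red_mul_eval (N := n + 1) (M := M) (contDiff_dz hf)
    (genPoly n fun k => dz (μ k) z))
  have e2 := hpow.trans (red_mul_eval (N := n + 1) (M := M) (hb (-Complex.I)) (derivative M))
  have e3 := hpow.trans (red_mul_eval (N := n + 1) (M := M) (contDiff_dzbar hf)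
    (genPoly n fun k => dzbar (μ k) z))
  have e4 := (derivative_red hf (X_dvd_genPoly n fun k => μ k z) n).mul_right
    (genPoly n fun k => dz (μ k) z)
  convert dvd_sub (dvd_add (dvd_sub e1 e2) e3) e4 using 1
  rw [C_neg, C_1]
  ring

/-- Modulo the ideal, the Poisson bracket `{F, -p̄ + μ₂ p + ⋯ + μ_n p^{n-1}}` depends only on the
reduction `w₁ p + ⋯ + w_{n-1} p^{n-1}` of `F`, through the displayed formula. -/
theorem coeff_subst_poisson (hU : IsOpen U) (hμ : ∀ k, ContDiffOn ℝ ∞ (μ k) U)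
    (hF : ContDiffOn ℝ ∞ F (U ×ˢ univ)) (hF0 : ∀ z ∈ U, F (z, 0) = 0) (hz : z ∈ U) {j : ℕ}
    (hj : j < n) :
    (subst (genPoly n fun k => μ k z) (fibreTaylor n (poisson (fun z p => F (z, p))
        (fun z p => -(starRingEnd ℂ p) + ∑ k ∈ Finset.Icc 2 n, μ k z * p ^ (k - 1)) z))).coeff j
      = dzbar (redCoeff n μ F j) z + ∑ l ∈ Finset.Icc 2 (j + 1),
          (((j + 2 - l : ℕ) : ℂ) * redCoeff n μ F (j + 2 - l) z * dz (μ l) z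
            - ((l : ℂ) - 1) * μ l z * dz (redCoeff n μ F (j + 2 - l)) z) := by
  -- The term `l = j + 2` of `∂W M'` involves `∂w₀`, which vanishes because `w₀ = F(z, 0)`.
  have hw0 : dz (redCoeff n μ F 0) z = 0 := by
    have : redCoeff n μ F 0 =ᶠ[𝓝 z] fun _ => 0 := by
      filter_upwards [hU.mem_nhds hz] with z' hz'
      rw [redCoeff_zero, hF0 z' hz']
    rw [dz_eq_wd, wd_congr this, wd_const]
  rw [coeff_subst_fibreTaylor (X_dvd_genPoly n _) n _ hj,
    coeff_eq_of_X_pow_dvd (red_poisson hU hμ hF hz) hj, coeff_add, coeff_sub]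
  have hdz : ∀ i < n, (red (n + 1) (genPoly n fun k => μ k z)
        (fun p => wd ((1, 0) : ℂ × ℂ) (Complex.I, 0) (-Complex.I) F (z, p))
      + red (n + 1) (genPoly n fun k => μ k z) (dzbar fun p => F (z, p))
        * genPoly n fun k => dz (μ k) z).coeff i = dz (redCoeff n μ F i) z := fun i hi => by
    rw [dz_eq_wd]
    exact (wd_redCoeff (n := n) hU hμ hF hz (-Complex.I) hi).symm
  generalize red (n + 1) (genPoly n fun k => μ k z)
        (fun p => wd ((1, 0) : ℂ × ℂ) (Complex.I, 0) (-Complex.I) F (z, p))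
      + red (n + 1) (genPoly n fun k => μ k z) (dzbar fun p => F (z, p))
        * genPoly n (fun k => dz (μ k) z) = R at hdz ⊢
  have hdzbar : dzbar (redCoeff n μ F j) z = _ := wd_redCoeff hU hμ hF hz Complex.I hj
  rw [hdzbar, ← dzbar_eq_wd, add_comm]
  congr 1
  rw [Finset.sum_sub_distrib]
  have hsub : Finset.Icc 2 (j + 1) ⊆ Finset.Icc 2 n := Finset.Icc_subset_Icc_right hj
  congr 1
  · rw [genPoly.eq_1 n fun k => dz (μ k) z, Finset.mul_sum, finsetSum_coeff]
    symm
    refine Finset.sum_subset_zero_on_sdiff hsub (fun l hl => ?_) fun l hl => ?_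
    · simp only [Finset.mem_sdiff, Finset.mem_Icc] at hl
      rw [← mul_assoc, coeff_mul_X_pow', if_neg (by omega)]
    · rw [Finset.mem_Icc] at hl
      rw [← mul_assoc, coeff_mul_X_pow', if_pos (by omega), coeff_mul_C, coeff_derivative,
        redCoeff, show j + 2 - l = j - (l - 1) + 1 by omega]
      push_cast
      ring
  · have hder : derivative (genPoly n fun k => μ k z)
        = ∑ l ∈ Finset.Icc 2 n, C (((l : ℂ) - 1) * μ l z) * X ^ (l - 2) := by
      rw [genPoly, derivative_sum]
      refine Finset.sum_congr rfl fun l hl => ?_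
      rw [Finset.mem_Icc] at hl
      obtain ⟨i, rfl⟩ : ∃ i, l = i + 2 := ⟨l - 2, by omega⟩
      rw [derivative_C_mul, derivative_X_pow, C_mul]
      simp only [show i + 2 - 1 = i + 1 by omega, Nat.add_sub_cancel]
      push_cast
      ring_nf
    rw [hder, Finset.mul_sum, finsetSum_coeff]
    symm
    refine Finset.sum_subset_zero_on_sdiff hsub (fun l hl => ?_) fun l hl => ?_
    · simp only [Finset.mem_sdiff, Finset.mem_Icc] at hl
      rw [← mul_assoc, coeff_mul_X_pow']
      split_ifs with h
      · rw [coeff_mul_C, show j - (l - 2) = 0 by omega]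
        rw [hdz 0 (by omega), hw0, zero_mul]
      · rfl
    · rw [Finset.mem_Icc] at hl
      rw [← mul_assoc, coeff_mul_X_pow', if_pos (by omega), coeff_mul_C,
        hdz _ (by omega), show j + 2 - l = j - (l - 2) by omega]
      ring

end Poisson

/-! ### Changes of coordinates -/

/-- The differential is `∂f dz + ∂̄f dz̄`. -/
theorem fderiv_eq_dz_add_dzbar (f : ℂ → ℂ) (z v : ℂ) :
    fderiv ℝ f z v = dz f z * v + dzbar f z * starRingEnd ℂ v := by
  have h : fderiv ℝ f z v = v.re * fderiv ℝ f z 1 + v.im * fderiv ℝ f z Complex.I := by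
    have : v = v.re • (1 : ℂ) + v.im • Complex.I := by
      simp [Complex.re_add_im]
    conv_lhs => rw [this, map_add, map_smul, map_smul]
    simp
  have hv : v = v.re + v.im * Complex.I := (Complex.re_add_im v).symm
  have hc : starRingEnd ℂ v = v.re - v.im * Complex.I := by
    apply Complex.ext <;> simp
  have hI := Complex.I_mul_I
  rw [h, hc, dz, dzbar]
  conv_rhs => rw [hv]
  simp only [Complex.add_re, Complex.ofReal_re, Complex.mul_re, Complex.I_re, Complex.ofReal_im,
    Complex.I_im, Complex.add_im, Complex.mul_im, mul_zero, mul_one, sub_zero, add_zero,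
    zero_add]
  linear_combination (v.im * fderiv ℝ f z Complex.I) * hI

theorem dz_dzbar_of_fderiv_eq {f : ℂ → ℂ} {z α β : ℂ}
    (h : ∀ v, fderiv ℝ f z v = α * v + β * starRingEnd ℂ v) : dz f z = α ∧ dzbar f z = β := by
  have hI := Complex.I_mul_I
  constructor
  · rw [dz, h, h]
    simp only [map_one, Complex.conj_I]
    linear_combination (-(1 / 2) * α + (1 / 2) * β) * hI
  · rw [dzbar, h, h]
    simp only [map_one, Complex.conj_I]
    linear_combination ((1 / 2) * α - (1 / 2) * β) * hI

/-- The chain rule for Wirtinger derivatives and a holomorphic inner function. -/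
theorem dz_comp {f τ : ℂ → ℂ} {z : ℂ} (hf : DifferentiableAt ℝ f (τ z))
    (hτ : DifferentiableAt ℂ τ z) :
    dz (fun u => f (τ u)) z = dz f (τ z) * deriv τ z
      ∧ dzbar (fun u => f (τ u)) z = dzbar f (τ z) * starRingEnd ℂ (deriv τ z) := by
  refine dz_dzbar_of_fderiv_eq fun v => ?_
  have h : HasFDerivAt τ
      ((ContinuousLinearMap.toSpanSingleton ℂ (deriv τ z)).restrictScalars ℝ) z :=
    hτ.hasDerivAt.hasFDerivAt.restrictScalars ℝ
  have h2 := (hf.hasFDerivAt.comp z h).fderiv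
  change fderiv ℝ (f ∘ τ) z v = _
  rw [h2]
  simp only [ContinuousLinearMap.comp_apply, ContinuousLinearMap.coe_restrictScalars',
    ContinuousLinearMap.toSpanSingleton_apply, smul_eq_mul, fderiv_eq_dz_add_dzbar, map_mul]
  ring

theorem dz_conj {f : ℂ → ℂ} {z : ℂ} (hf : DifferentiableAt ℝ f z) :
    dz (fun u => starRingEnd ℂ (f u)) z = starRingEnd ℂ (dzbar f z)
      ∧ dzbar (fun u => starRingEnd ℂ (f u)) z = starRingEnd ℂ (dz f z) := by
  refine dz_dzbar_of_fderiv_eq fun v => ?_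
  have h := (Complex.conjCLE.hasFDerivAt.comp z hf.hasFDerivAt).fderiv
  change fderiv ℝ (Complex.conjCLE ∘ f) z v = _
  rw [h]
  simp [fderiv_eq_dz_add_dzbar]
  ring

theorem dz_mul {f g : ℂ → ℂ} {z : ℂ} (hf : DifferentiableAt ℝ f z) (hg : DifferentiableAt ℝ g z) :
    dz (fun u => f u * g u) z = f z * dz g z + g z * dz f z := by
  rw [dz_eq_wd, wd_mul hf hg]

theorem dzbar_mul {f g : ℂ → ℂ} {z : ℂ} (hf : DifferentiableAt ℝ f z)
    (hg : DifferentiableAt ℝ g z) :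
    dzbar (fun u => f u * g u) z = f z * dzbar g z + g z * dzbar f z := by
  rw [dzbar_eq_wd, wd_mul hf hg]

section Surface

variable {X : Type*} [TopologicalSpace X] [ChartedSpace ℂ X]

/-- The change of coordinates from the chart `e` to the chart `e'`. -/
def trans (e e' : atlas ℂ X) (u : ℂ) : ℂ := e'.1 (e.1.symm u)

/-- The domain of the change of coordinates from the chart `e` to the chart `e'`. -/
def overlap (e e' : atlas ℂ X) : Set ℂ := e.1.target ∩ e.1.symm ⁻¹' e'.1.source

theorem isOpen_overlap (e e' : atlas ℂ X) : IsOpen (overlap e e') :=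
  e.1.isOpen_inter_preimage_symm e'.1.open_source

theorem trans_mem_overlap {e e' : atlas ℂ X} {z : ℂ} (hz : z ∈ overlap e e') :
    trans e e' z ∈ overlap e' e := by
  refine ⟨e'.1.map_source hz.2, ?_⟩
  rw [mem_preimage, trans, e'.1.left_inv hz.2]
  exact e.1.map_target hz.1

theorem symm_trans {e e' : atlas ℂ X} {z : ℂ} (hz : z ∈ overlap e e') :
    e'.1.symm (trans e e' z) = e.1.symm z := by
  rw [trans, e'.1.left_inv hz.2]

theorem trans_trans {e e' : atlas ℂ X} {z : ℂ} (hz : z ∈ overlap e e') :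
    trans e' e (trans e e' z) = z := by
  rw [trans, symm_trans hz, e.1.right_inv hz.1]

variable [IsManifold 𝓘(ℂ, ℂ) ω X]

theorem contDiffOn_trans (e e' : atlas ℂ X) : ContDiffOn ℂ ω (trans e e') (overlap e e') := by
  rw [← contMDiffOn_iff_contDiffOn]
  have h1 : ContMDiffOn 𝓘(ℂ, ℂ) 𝓘(ℂ, ℂ) ω e.1.symm e.1.target :=
    contMDiffOn_symm_of_mem_maximalAtlas (IsManifold.subset_maximalAtlas e.2)
  have h2 : ContMDiffOn 𝓘(ℂ, ℂ) 𝓘(ℂ, ℂ) ω e'.1 e'.1.source :=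
    contMDiffOn_of_mem_maximalAtlas (IsManifold.subset_maximalAtlas e'.2)
  exact h2.comp (h1.mono inter_subset_left) inter_subset_right

theorem contDiffOn_deriv_trans (e e' : atlas ℂ X) :
    ContDiffOn ℂ ∞ (deriv (trans e e')) (overlap e e') :=
  (contDiffOn_trans e e').deriv_of_isOpen (isOpen_overlap e e') (by simp)

theorem differentiableAt_trans {e e' : atlas ℂ X} {z : ℂ} (hz : z ∈ overlap e e') :
    DifferentiableAt ℂ (trans e e') z :=
  ((contDiffOn_trans e e').contDiffAt ((isOpen_overlap e e').mem_nhds hz)).differentiableAt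
    (by simp)

theorem deriv_trans_mul {e e' : atlas ℂ X} {z : ℂ} (hz : z ∈ overlap e e') :
    deriv (trans e' e) (trans e e' z) * deriv (trans e e') z = 1 := by
  have h1 := (differentiableAt_trans (trans_mem_overlap hz)).hasDerivAt.comp z
    (differentiableAt_trans hz).hasDerivAt
  have h2 : trans e' e ∘ trans e e' =ᶠ[𝓝 z] id := by
    filter_upwards [(isOpen_overlap e e').mem_nhds hz] with u hu using trans_trans hu
  exact (h1.congr_of_eventuallyEq h2.symm).unique (hasDerivAt_id z)

theorem deriv_trans_ne_zero {e e' : atlas ℂ X} {z : ℂ} (hz : z ∈ overlap e e') :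
    deriv (trans e e') z ≠ 0 :=
  right_ne_zero_of_mul_eq_one (deriv_trans_mul hz)

end Surface

/-! ### Sections of `K^a ⊗ K̄^b` -/

section Sections

variable {X : Type*} [TopologicalSpace X] [ChartedSpace ℂ X] {a b c d : ℤ}
  {f g : atlas ℂ X → ℂ → ℂ}

/-- The family `f` of functions on the images of the charts is a smooth section of `K^a ⊗ K̄^b`.
In contrast to `Differential`, nothing is required of the values outside the images of the
charts. -/
def IsSection (a b : ℤ) (f : atlas ℂ X → ℂ → ℂ) : Prop :=
  (∀ e : atlas ℂ X, ContDiffOn ℝ ∞ (f e) e.1.target) ∧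
  ∀ e e' : atlas ℂ X, ∀ z ∈ overlap e e',
    f e z = f e' (trans e e' z) * deriv (trans e e') z ^ a
      * starRingEnd ℂ (deriv (trans e e') z) ^ b

theorem IsSection.of_mem (hf : f ∈ Differential X a b) : IsSection a b f :=
  ⟨hf.1, fun e e' z hz => hf.2.2 e e' z hz.1 hz.2⟩

theorem IsSection.congr (hf : IsSection a b f) (h : ∀ e : atlas ℂ X, ∀ z ∈ e.1.target,
    g e z = f e z) : IsSection a b g :=
  ⟨fun e => (hf.1 e).congr (h e), fun e e' z hz => by
    rw [h e z hz.1, h e' _ (trans_mem_overlap hz).1, hf.2 e e' z hz]⟩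

/-- The extension of a section by zero outside the images of the charts. -/
def extendZero (f : atlas ℂ X → ℂ → ℂ) : atlas ℂ X → ℂ → ℂ :=
  fun e => e.1.target.indicator (f e)

theorem extendZero_apply {e : atlas ℂ X} {z : ℂ} (hz : z ∈ e.1.target) :
    extendZero f e z = f e z :=
  indicator_of_mem hz _

theorem IsSection.extendZero_mem (hf : IsSection a b f) : extendZero f ∈ Differential X a b := by
  have h : IsSection a b (extendZero f) := hf.congr fun e z hz => extendZero_apply hz
  exact ⟨h.1, fun e z hz => indicator_of_notMem hz _, fun e e' z hz hz' => h.2 e e' z ⟨hz, hz'⟩⟩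

theorem IsSection.zero : IsSection (X := X) a b fun _ _ => 0 :=
  ⟨fun _ => contDiffOn_const, fun _ _ _ _ => by simp⟩

theorem IsSection.const (r : ℂ) : IsSection (X := X) 0 0 fun _ _ => r :=
  ⟨fun _ => contDiffOn_const, fun _ _ _ _ => by simp⟩

theorem IsSection.add (hf : IsSection a b f) (hg : IsSection a b g) :
    IsSection a b fun e z => f e z + g e z :=
  ⟨fun e => (hf.1 e).add (hg.1 e), fun e e' z hz => by
    beta_reduce; rw [hf.2 e e' z hz, hg.2 e e' z hz]; ring⟩

theorem IsSection.const_mul (r : ℂ) (hf : IsSection a b f) :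
    IsSection a b fun e z => r * f e z :=
  ⟨fun e => contDiffOn_const.mul (hf.1 e), fun e e' z hz => by
    beta_reduce; rw [hf.2 e e' z hz]; ring⟩

theorem IsSection.sum {ι : Type*} (s : Finset ι) {f : ι → atlas ℂ X → ℂ → ℂ}
    (hf : ∀ i ∈ s, IsSection a b (f i)) : IsSection a b fun e z => ∑ i ∈ s, f i e z :=
  ⟨fun e => ContDiffOn.sum fun i hi => (hf i hi).1 e, fun e e' z hz => by
    rw [Finset.sum_mul, Finset.sum_mul]
    exact Finset.sum_congr rfl fun i hi => (hf i hi).2 e e' z hz⟩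

theorem IsSection.differentiableAt (hf : IsSection a b f) {e : atlas ℂ X} {z : ℂ}
    (hz : z ∈ e.1.target) : DifferentiableAt ℝ (f e) z :=
  differentiableAt_of_contDiffOn e.1.open_target (hf.1 e) hz

variable [IsManifold 𝓘(ℂ, ℂ) ω X]

theorem IsSection.mul (hf : IsSection a b f) (hg : IsSection c d g) :
    IsSection (a + c) (b + d) fun e z => f e z * g e z :=
  ⟨fun e => (hf.1 e).mul (hg.1 e), fun e e' z hz => by
    have h := deriv_trans_ne_zero hz
    beta_reduce
    rw [hf.2 e e' z hz, hg.2 e e' z hz, zpow_add₀ h, zpow_add₀ ((_root_.map_ne_zero _).2 h)]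
    ring⟩

/-- The Wirtinger derivatives of a section in two charts. -/
theorem IsSection.wirtinger (hf : IsSection a b f) {e e' : atlas ℂ X} {z : ℂ}
    (hz : z ∈ overlap e e') :
    dz (f e) z = (dz (f e') (trans e e' z) * deriv (trans e e') z
          + a * f e' (trans e e' z) * (deriv (deriv (trans e e')) z / deriv (trans e e') z))
        * deriv (trans e e') z ^ a * starRingEnd ℂ (deriv (trans e e') z) ^ b
      ∧ dzbar (f e) z = (dzbar (f e') (trans e e' z) * starRingEnd ℂ (deriv (trans e e') z)
          + b * f e' (trans e e' z)
            * starRingEnd ℂ (deriv (deriv (trans e e')) z / deriv (trans e e') z))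
        * deriv (trans e e') z ^ a * starRingEnd ℂ (deriv (trans e e') z) ^ b := by
  set τ := trans e e' with hτ
  have hT : deriv τ z ≠ 0 := deriv_trans_ne_zero hz
  have hTc : starRingEnd ℂ (deriv τ z) ≠ 0 := (_root_.map_ne_zero _).2 hT
  have hmem := (isOpen_overlap e e').mem_nhds hz
  have heq : f e =ᶠ[𝓝 z] fun u => f e' (τ u) * (deriv τ u ^ a * starRingEnd ℂ (deriv τ u ^ b)) := by
    filter_upwards [hmem] with u hu
    rw [hf.2 e e' u hu, map_zpow₀, mul_assoc]
  have hfd : DifferentiableAt ℝ (f e') (τ z) := hf.differentiableAt (trans_mem_overlap hz).1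
  have hτd : DifferentiableAt ℂ τ z := differentiableAt_trans hz
  have hτ' : DifferentiableAt ℂ (deriv τ) z :=
    ((contDiffOn_deriv_trans e e').contDiffAt hmem).differentiableAt (by simp)
  have hpow : ∀ k : ℤ, HasDerivAt (fun u => deriv τ u ^ k)
      (k * deriv τ z ^ (k - 1) * deriv (deriv τ) z) z := fun k =>
    (hasDerivAt_zpow k _ (Or.inl hT)).comp z hτ'.hasDerivAt
  have hpow' := fun k : ℤ => dz_of_holomorphic (hpow k).differentiableAt
  have hpR : ∀ k : ℤ, DifferentiableAt ℝ (fun u => deriv τ u ^ k) z := fun k =>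
    (hpow k).differentiableAt.restrictScalars ℝ
  have hcR : ∀ k : ℤ, DifferentiableAt ℝ (fun u => starRingEnd ℂ (deriv τ u ^ k)) z := fun k =>
    Complex.conjCLE.differentiableAt.comp z (hpR k)
  have hfτ : DifferentiableAt ℝ (fun u => f e' (τ u)) z :=
    hfd.comp z (hτd.restrictScalars ℝ)
  have e1 : dz (f e) z
      = dz (fun u => f e' (τ u) * (deriv τ u ^ a * starRingEnd ℂ (deriv τ u ^ b))) z := by
    rw [dz_eq_wd]; exact wd_congr heq
  have e2 : dzbar (f e) z
      = dzbar (fun u => f e' (τ u) * (deriv τ u ^ a * starRingEnd ℂ (deriv τ u ^ b))) z := by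
    rw [dzbar_eq_wd]; exact wd_congr heq
  rw [e1, e2, dz_mul hfτ ((hpR a).fun_mul (hcR b)), dz_mul (hpR a) (hcR b),
    dzbar_mul hfτ ((hpR a).fun_mul (hcR b)), dzbar_mul (hpR a) (hcR b), (dz_conj (hpR b)).1,
    (dz_conj (hpR b)).2, (hpow' a).1, (hpow' a).2, (hpow' b).1, (hpow' b).2, (dz_comp hfd hτd).1,
    (dz_comp hfd hτd).2, (hpow a).deriv, (hpow b).deriv, zpow_sub_one₀ hT, zpow_sub_one₀ hT]
  simp only [map_mul, map_zero, map_zpow₀, map_inv₀, map_div₀, map_intCast]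
  constructor <;> · field_simp; ring

/-- `∂̄` on sections of `K^a`. -/
theorem IsSection.dzbar (hf : IsSection a 0 f) : IsSection a 1 fun e => dzbar (f e) :=
  ⟨fun e => contDiffOn_wd e.1.open_target (hf.1 e), fun e e' z hz => by
    beta_reduce
    rw [(hf.wirtinger hz).2]
    simp
    ring⟩

/-- `∂` on sections of `K̄^b`. -/
theorem IsSection.dz (hf : IsSection 0 b f) : IsSection 1 b fun e => dz (f e) :=
  ⟨fun e => by rw [dz_eq_wd]; exact contDiffOn_wd e.1.open_target (hf.1 e), fun e e' z hz => by
    beta_reduce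
    rw [(hf.wirtinger hz).1]
    simp⟩

/-- The bilinear operator `a f ∂g - c g ∂f`, in which the second derivatives of the changes of
coordinates cancel. -/
theorem IsSection.bracket (hf : IsSection a b f) (hg : IsSection c d g) :
    IsSection (a + c + 1) (b + d)
      fun e z => a * (f e z * HigherComplex.dz (g e) z)
        - c * (g e z * HigherComplex.dz (f e) z) := by
  refine ⟨fun e => ?_, fun e e' z hz => ?_⟩
  · have h1 : ContDiffOn ℝ ∞ (HigherComplex.dz (f e)) e.1.target := by
      rw [dz_eq_wd]; exact contDiffOn_wd e.1.open_target (hf.1 e)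
    have h2 : ContDiffOn ℝ ∞ (HigherComplex.dz (g e)) e.1.target := by
      rw [dz_eq_wd]; exact contDiffOn_wd e.1.open_target (hg.1 e)
    exact (contDiffOn_const.mul ((hf.1 e).mul h2)).sub (contDiffOn_const.mul ((hg.1 e).mul h1))
  · have hT := deriv_trans_ne_zero hz
    beta_reduce
    rw [(hf.wirtinger hz).1, (hg.wirtinger hz).1, hf.2 e e' z hz, hg.2 e e' z hz,
      zpow_add₀ hT, zpow_add₀ hT, zpow_add₀ ((_root_.map_ne_zero _).2 hT), zpow_one]
    ring

end Sections

section Hamiltonian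

variable {X : Type*} [TopologicalSpace X] [ChartedSpace ℂ X]

/-! ### Hamiltonians in coordinates -/

/-- A Hamiltonian in the coordinates `(z, p)` of a chart. -/
def localHam (H : RealCotangent X → ℝ) (e : atlas ℂ X) (q : ℂ × ℂ) : ℂ :=
  ((H (covectorAt e q.1 q.2) : ℝ) : ℂ)

/-- The point of `T*X` over `x` with the covector `2 Re (q ·)`, in the identification of the tangent
space with `ℂ` that Mathlib's tangent bundle uses. -/
def stdCovector (x : X) (q : ℂ) : RealCotangent X :=
  ⟨x, ((2 : ℝ) • Complex.reCLM.comp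
    ((q • ContinuousLinearMap.id ℂ ℂ).restrictScalars ℝ) : ℂ →L[ℝ] ℝ)⟩

/-- The derivative of a chart. The tangent space is the model space `ℂ` by definition, and is read
as such here. -/
def chartLin (e : atlas ℂ X) (x : X) : ℂ →L[ℂ] ℂ :=
  mfderiv 𝓘(ℂ, ℂ) 𝓘(ℂ, ℂ) e.1 x

/-- The derivative of a chart, as a complex number. -/
def chartDeriv (e : atlas ℂ X) (x : X) : ℂ :=
  chartLin e x 1

theorem covectorAt_apply {e : atlas ℂ X} {x : X} (hx : x ∈ e.1.source) (p : ℂ) :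
    covectorAt e (e.1 x) p = stdCovector x (p * chartDeriv e x) := by
  rw [covectorAt, e.1.left_inv hx]
  refine Sigma.ext rfl (heq_of_eq (ContinuousLinearMap.ext fun v : ℂ => ?_))
  have h : chartLin e x v = v * chartDeriv e x := by
    have := (chartLin e x).map_smul v 1
    rwa [smul_eq_mul, smul_eq_mul, mul_one] at this
  change (2 : ℝ) * (p * chartLin e x v).re
    = (2 : ℝ) * (p * chartDeriv e x * v).re
  rw [h, mul_assoc, mul_comm v]

theorem covectorAt_zero_mem (e : atlas ℂ X) (z : ℂ) : covectorAt e z 0 ∈ zeroSection X := by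
  change (covectorAt e z 0).2 = 0
  refine ContinuousLinearMap.ext fun v : ℂ => ?_
  change (2 : ℝ) * (0 * chartLin e (e.1.symm z) v).re = 0
  simp

theorem IsHigherHamiltonian.contDiffOn {H : RealCotangent X → ℝ} (hH : IsHigherHamiltonian H)
    (e : atlas ℂ X) : ContDiffOn ℝ ∞ (localHam H e) (e.1.target ×ˢ univ) :=
  hH.1 e

theorem IsHigherHamiltonian.localHam_zero {H : RealCotangent X → ℝ} (hH : IsHigherHamiltonian H)
    (e : atlas ℂ X) (z : ℂ) : localHam H e (z, 0) = 0 := by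
  rw [localHam, hH.2 _ (covectorAt_zero_mem e z), Complex.ofReal_zero]

/-- The coefficient `w_j` of `p^j` in the reduction of a Hamiltonian modulo the ideal. -/
def hamCoeff {n : ℕ} (μ : CompatibleStructure X n) (H : RealCotangent X → ℝ) (j : ℕ)
    (e : atlas ℂ X) : ℂ → ℂ :=
  redCoeff n (fun k => μ.1 k e) (localHam H e) j

/-! ### The variation induced by a Hamiltonian -/

/-- The variation `δμ_m = ∂̄w_{m-1} + ∑_l (k w_k ∂μ_l - (l-1) μ_l ∂w_k)`, `k = m + 1 - l`, given by
`w₁ p + ⋯ + w_{n-1} p^{n-1}`. -/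
def variationFormula {n : ℕ} (μ : CompatibleStructure X n) (w : ℕ → atlas ℂ X → ℂ → ℂ) (m : ℕ)
    (e : atlas ℂ X) (z : ℂ) : ℂ :=
  dzbar (w (m - 1) e) z + ∑ l ∈ Finset.Icc 2 m,
    (((m + 1 - l : ℕ) : ℂ) * w (m + 1 - l) e z * dz (μ.1 l e) z
      - ((l : ℂ) - 1) * μ.1 l e z * dz (w (m + 1 - l) e) z)

/-- A variation is induced by a Hamiltonian exactly when it is given by `variationFormula`. -/
theorem isHamiltonianVariation_iff {n : ℕ} (μ : CompatibleStructure X n)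
    {H : RealCotangent X → ℝ} (hH : IsHigherHamiltonian H) (δ : Variation X n) :
    IsHamiltonianVariation μ H δ ↔ ∀ m ∈ Finset.Icc 2 n, ∀ e : atlas ℂ X, ∀ z ∈ e.1.target,
      δ.1 m e z = variationFormula μ (hamCoeff μ H) m e z := by
  have key : ∀ e : atlas ℂ X, ∀ z ∈ e.1.target,
      (fibreTaylor n (poisson (fun z' p' => ((H (covectorAt e z' p') : ℝ) : ℂ)) (generator μ e) z)
        - ∑ k ∈ Finset.Icc 2 n, MvPolynomial.C (δ.1 k e z) * MvPolynomial.X 0 ^ (k - 1)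
        ∈ structureIdeal μ e z) ↔
      ∀ m ∈ Finset.Icc 2 n, δ.1 m e z = variationFormula μ (hamCoeff μ H) m e z := by
    intro e z hz
    have hμs : ∀ k, ContDiffOn ℝ ∞ (μ.1 k e) e.1.target := fun k => (μ.2.1 k).1 e
    have hpois := fun j (hj : j < n) => coeff_subst_poisson (n := n) e.1.open_target hμs
      (hH.contDiffOn e) (fun z _ => hH.localHam_zero e z) hz hj
    rw [structureIdeal, mem_span_iff_X_pow_dvd n _ (genPoly n fun k => μ.1 k e z)
      (by simp [genPoly]), X_pow_dvd_iff]
    have hδ : subst (genPoly n fun k => μ.1 k e z)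
        (∑ k ∈ Finset.Icc 2 n, MvPolynomial.C (δ.1 k e z) * MvPolynomial.X 0 ^ (k - 1))
        = genPoly n fun k => δ.1 k e z := by
      simp [genPoly]
    have hcoeff : ∀ j < n, (subst (genPoly n fun k => μ.1 k e z)
        (fibreTaylor n (poisson (fun z' p' => ((H (covectorAt e z' p') : ℝ) : ℂ))
          (generator μ e) z))).coeff j = variationFormula μ (hamCoeff μ H) (j + 1) e z :=
      fun j hj => hpois j hj
    simp only [map_sub, hδ, coeff_sub, sub_eq_zero]
    constructor
    · intro h m hm
      have hm' := Finset.mem_Icc.1 hm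
      have := h (m - 1) (by omega)
      rw [hcoeff _ (by omega), coeff_genPoly, Nat.sub_add_cancel (by omega), if_pos hm] at this
      exact this.symm
    · intro h j hj
      rw [hcoeff j hj, coeff_genPoly]
      split_ifs with hm
      · exact (h _ hm).symm
      · obtain rfl : j = 0 := by
          rw [Finset.mem_Icc] at hm; omega
        have h0 : hamCoeff μ H 0 e = fun _ => 0 := by
          funext z
          rw [hamCoeff, redCoeff_zero, hH.localHam_zero]
        simp [variationFormula, h0, dzbar_eq_wd]
  exact ⟨fun h m hm e z hz => (key e z hz).1 (h e z hz) m hm, fun h e z hz =>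
    (key e z hz).2 fun m hm => h m hm e z hz⟩

variable [IsManifold 𝓘(ℂ, ℂ) ω X]

theorem chartDeriv_trans {e e' : atlas ℂ X} {x : X} (hx : x ∈ e.1.source)
    (hx' : x ∈ e'.1.source) :
    chartDeriv e' x = deriv (trans e e') (e.1 x) * chartDeriv e x := by
  have : IsManifold 𝓘(ℂ, ℂ) 1 X := IsManifold.of_le (n := ω) (by simp)
  have hz : e.1 x ∈ overlap e e' := ⟨e.1.map_source hx, by
    rw [mem_preimage, e.1.left_inv hx]; exact hx'⟩
  have heq : e'.1 =ᶠ[𝓝 x] trans e e' ∘ e.1 := by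
    filter_upwards [e.1.open_source.mem_nhds hx] with y hy
    rw [Function.comp_apply, trans, e.1.left_inv hy]
  have h1 : MDifferentiableAt 𝓘(ℂ, ℂ) 𝓘(ℂ, ℂ) e.1 x := mdifferentiableAt_atlas e.2 hx
  have h2 : MDifferentiableAt 𝓘(ℂ, ℂ) 𝓘(ℂ, ℂ) (trans e e') (e.1 x) :=
    (differentiableAt_trans hz).mdifferentiableAt
  have h3 := (differentiableAt_trans hz).hasDerivAt.hasFDerivAt.fderiv
  have h4 : mfderiv 𝓘(ℂ, ℂ) 𝓘(ℂ, ℂ) e'.1 x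
      = (mfderiv 𝓘(ℂ, ℂ) 𝓘(ℂ, ℂ) (trans e e') (e.1 x)).comp
          (mfderiv 𝓘(ℂ, ℂ) 𝓘(ℂ, ℂ) e.1 x) := by
    rw [← mfderiv_comp x h2 h1]
    exact heq.mfderiv_eq
  rw [mfderiv_eq_fderiv, h3] at h4
  have h5 : chartLin e' x = (ContinuousLinearMap.toSpanSingleton ℂ
      (deriv (trans e e') (e.1 x))).comp (chartLin e x) := h4
  rw [chartDeriv, h5, ContinuousLinearMap.comp_apply,
    ContinuousLinearMap.toSpanSingleton_apply, smul_eq_mul, mul_comm, chartDeriv]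

/-- The coordinate `p` transforms by the derivative of the change of coordinates. -/
theorem covectorAt_trans {e e' : atlas ℂ X} {z : ℂ} (hz : z ∈ overlap e e') (p : ℂ) :
    covectorAt e z p = covectorAt e' (trans e e' z) ((deriv (trans e e') z)⁻¹ * p) := by
  have hT := deriv_trans_ne_zero hz
  obtain ⟨x, hx, rfl⟩ : ∃ x ∈ e.1.source, e.1 x = z :=
    ⟨e.1.symm z, e.1.map_target hz.1, e.1.right_inv hz.1⟩
  have hx' : x ∈ e'.1.source := by simpa [overlap, hx] using hz
  have h1 : trans e e' (e.1 x) = e'.1 x := by rw [trans, e.1.left_inv hx]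
  rw [h1, covectorAt_apply hx, covectorAt_apply hx', chartDeriv_trans hx hx']
  congr 1
  field_simp

theorem localHam_trans (H : RealCotangent X → ℝ) {e e' : atlas ℂ X} {z : ℂ}
    (hz : z ∈ overlap e e') (p : ℂ) :
    localHam H e (z, p) = localHam H e' (trans e e' z, (deriv (trans e e') z)⁻¹ * p) := by
  rw [localHam, covectorAt_trans hz]
  rfl

/-- A first-order operator that satisfies `D (f (r ·)) = s (D f) (r ·)` can be iterated. -/
theorem iterate_comp_mul {D : (ℂ → ℂ) → ℂ → ℂ} {r s : ℂ}
    (h : ∀ f : ℂ → ℂ, ContDiff ℝ ∞ f → ContDiff ℝ ∞ (D f) ∧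
      (∀ k : ℂ, D (fun p => k * f (r * p)) = fun p => k * (s * D f (r * p))))
    {g : ℂ → ℂ} (hg : ContDiff ℝ ∞ g) (a : ℕ) :
    ContDiff ℝ ∞ (D^[a] g) ∧
      ∀ k : ℂ, D^[a] (fun p => k * g (r * p)) = fun p => k * (s ^ a * D^[a] g (r * p)) := by
  induction a with
  | zero => exact ⟨hg, fun k => by simp⟩
  | succ a ih =>
    refine ⟨?_, fun k => ?_⟩
    · rw [Function.iterate_succ_apply']; exact (h _ ih.1).1
    · rw [Function.iterate_succ_apply', ih.2 k]
      have := (h _ ih.1).2 (k * s ^ a)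
      simp only [← mul_assoc] at this ⊢
      rw [this]
      funext p
      rw [Function.iterate_succ_apply']
      ring

/-- The effect on Taylor coefficients of rescaling the fibre coordinate. -/
theorem jet_comp_mul {g : ℂ → ℂ} (hg : ContDiff ℝ ∞ g) (r : ℂ) (a b : ℕ) :
    jet a b (fun p => g (r * p)) = r ^ a * starRingEnd ℂ r ^ b * jet a b g := by
  have hlin : ∀ p : ℂ, HasDerivAt (fun p => r * p) r p := fun p => by
    simpa using (hasDerivAt_id p).const_mul r
  have hc : ∀ {f : ℂ → ℂ} (_ : ContDiff ℝ ∞ f) (p : ℂ),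
      DifferentiableAt ℝ (fun p => f (r * p)) p := fun hf p =>
    (hf.differentiable (by simp) _).comp p ((hlin p).differentiableAt.restrictScalars ℝ)
  have h1 := iterate_comp_mul (D := dzbar) (r := r) (s := starRingEnd ℂ r) (fun f hf =>
    ⟨contDiff_dzbar hf, fun k => funext fun p => by
      have := (dz_comp (hf.differentiable (by simp) (r * p)) (hlin p).differentiableAt).2
      rw [(hlin p).deriv] at this
      rw [dzbar_eq_wd] at this ⊢
      rw [wd_const_mul k (hc hf p), this, mul_comm (starRingEnd ℂ r)]⟩) hg b
  have h2 := iterate_comp_mul (D := dz) (r := r) (s := r) (fun f hf =>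
    ⟨contDiff_dz hf, fun k => funext fun p => by
      have := (dz_comp (hf.differentiable (by simp) (r * p)) (hlin p).differentiableAt).1
      rw [(hlin p).deriv] at this
      rw [dz_eq_wd] at this ⊢
      rw [wd_const_mul k (hc hf p), this, mul_comm r (wd _ _ _ _ _)]⟩) h1.1 a
  have h3 := h1.2 1
  simp only [one_mul] at h3
  rw [jet, h3, h2.2, jet]
  simp only [mul_zero]
  ring

/-- The Taylor coefficients of a Hamiltonian along the zero section are sections of
`K^{-a} ⊗ K̄^{-b}`. -/
theorem isSection_jet {H : RealCotangent X → ℝ} (hH : IsHigherHamiltonian H) (a b : ℕ) :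
    IsSection (-(a : ℤ)) (-(b : ℤ)) fun e z => jet a b fun p => localHam H e (z, p) := by
  refine ⟨fun e => contDiffOn_jet_slice e.1.open_target (hH.contDiffOn e) a b,
    fun e e' z hz => ?_⟩
  have h1 := jet_comp_mul (contDiff_slice (hH.contDiffOn e') (trans_mem_overlap hz).1)
    (deriv (trans e e') z)⁻¹ a b
  simp only [localHam_trans H hz]
  rw [h1]
  simp only [map_inv₀, zpow_neg, zpow_natCast, inv_pow]
  ring

/-- The coefficients of the powers of `μ₂ p + ⋯ + μ_n p^{n-1}`. -/
theorem isSection_coeff_genPoly_pow {n : ℕ} (μ : CompatibleStructure X n) (b j : ℕ) :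
    IsSection (-(j : ℤ)) (b : ℤ) fun e z => ((genPoly n fun k => μ.1 k e z) ^ b).coeff j := by
  induction b generalizing j with
  | zero =>
    by_cases hj : j = 0
    · subst hj
      simpa using IsSection.const 1
    · simpa [coeff_one, hj] using IsSection.zero
  | succ b ih =>
    simp only [pow_succ, coeff_mul]
    refine IsSection.sum _ fun x hx => ?_
    rw [Finset.HasAntidiagonal.mem_antidiagonal] at hx
    have h1 : IsSection (-(x.2 : ℤ)) 1 fun e z => (genPoly n fun k => μ.1 k e z).coeff x.2 := by
      simp only [coeff_genPoly]
      split_ifs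
      · have := IsSection.of_mem (μ.2.1 (x.2 + 1))
        convert this using 1
        push_cast
        ring
      · exact IsSection.zero
    convert (ih x.1).mul h1 using 1
    · rw [← hx]
      push_cast
      ring
    · push_cast
      ring

theorem isSection_hamCoeff {n : ℕ} (μ : CompatibleStructure X n) {H : RealCotangent X → ℝ}
    (hH : IsHigherHamiltonian H) (j : ℕ) : IsSection (-(j : ℤ)) 0 (hamCoeff μ H j) := by
  have : hamCoeff μ H j = fun e z => ∑ a ∈ Finset.range (n + 1), ∑ b ∈ Finset.range (n + 1),
      (jet a b fun p => localHam H e (z, p))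
        * ((Polynomial.X : ℂ[X]) ^ a * (genPoly n fun k => μ.1 k e z) ^ b).coeff j := by
    funext e z
    simp [hamCoeff, redCoeff, red, finsetSum_coeff]
  rw [this]
  refine IsSection.sum _ fun a _ => IsSection.sum _ fun b _ => ?_
  have h1 : IsSection ((a : ℤ) - j) (b : ℤ)
      fun (e : atlas ℂ X) z =>
        ((Polynomial.X : ℂ[X]) ^ a * (genPoly n fun k => μ.1 k e z) ^ b).coeff j := by
    simp only [coeff_X_pow_mul']
    split_ifs with h
    · convert isSection_coeff_genPoly_pow μ b (j - a) using 1
      push_cast [h]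
      ring
    · exact IsSection.zero
  convert (isSection_jet hH a b).mul h1 using 1 <;> ring

theorem isSection_variationFormula {n : ℕ} (μ : CompatibleStructure X n)
    {w : ℕ → atlas ℂ X → ℂ → ℂ} (hw : ∀ k : ℕ, IsSection (-(k : ℤ)) 0 (w k)) {m : ℕ}
    (hm : 1 ≤ m) : IsSection (1 - (m : ℤ)) 1 (variationFormula μ w m) := by
  have h1 : IsSection (1 - (m : ℤ)) 1 fun e => dzbar (w (m - 1) e) := by
    convert (hw (m - 1)).dzbar using 1
    push_cast [hm]
    ring
  refine h1.add (IsSection.sum _ fun l hl => ?_)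
  rw [Finset.mem_Icc] at hl
  have h2 := ((hw (m + 1 - l)).bracket (IsSection.of_mem (μ.2.1 l))).const_mul (-1)
  convert h2 using 1
  · push_cast [show l ≤ m + 1 by omega]
    ring
  · simp
  · funext e z
    push_cast [show l ≤ m + 1 by omega]
    ring

/-- Every Hamiltonian induces a variation. -/
theorem exists_isHamiltonianVariation {n : ℕ} (μ : CompatibleStructure X n)
    {H : RealCotangent X → ℝ} (hH : IsHigherHamiltonian H) :
    ∃ δ : Variation X n, IsHamiltonianVariation μ H δ := by
  classical
  refine ⟨⟨fun m => if m ∈ Finset.Icc 2 n then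
    extendZero (variationFormula μ (hamCoeff μ H) m) else 0, fun k => ?_, fun k hk => if_neg hk⟩,
    (isHamiltonianVariation_iff μ hH _).2 fun m hm e z hz => ?_⟩
  · beta_reduce
    split_ifs with hk
    · exact (isSection_variationFormula μ (isSection_hamCoeff μ hH)
        (by rw [Finset.mem_Icc] at hk; omega)).extendZero_mem
    · exact zero_mem _
  · simp only [if_pos hm, extendZero_apply hz]

end Hamiltonian

/-! ### Integration of `(1,1)`-forms -/

section Planar

open MeasureTheory

theorem integrableOn_of_eq_zero_off_compact {U K : Set ℂ} {f : ℂ → ℂ} (hU : IsOpen U)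
    (hf : ContinuousOn f U) (hK : IsCompact K) (hKU : K ⊆ U) (h0 : ∀ z ∈ U, z ∉ K → f z = 0) :
    IntegrableOn f U :=
  ((hf.mono hKU).integrableOn_compact hK).of_forall_sdiff_eq_zero hU.measurableSet
    fun z hz => h0 z hz.1 hz.2

theorem contDiff_indicator {U K : Set ℂ} {g : ℂ → ℂ} (hU : IsOpen U) (hg : ContDiffOn ℝ ∞ g U)
    (hK : IsCompact K) (hKU : K ⊆ U) (h0 : ∀ z ∈ U, z ∉ K → g z = 0) :
    ContDiff ℝ ∞ (U.indicator g) := by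
  rw [contDiff_iff_contDiffAt]
  intro z
  by_cases hz : z ∈ U
  · refine (hg.contDiffAt (hU.mem_nhds hz)).congr_of_eventuallyEq ?_
    filter_upwards [hU.mem_nhds hz] with u hu using indicator_of_mem hu _
  · refine (contDiffAt_const (c := (0 : ℂ))).congr_of_eventuallyEq ?_
    filter_upwards [hK.isClosed.isOpen_compl.mem_nhds fun h => hz (hKU h)] with u hu
    by_cases huU : u ∈ U
    · rw [indicator_of_mem huU, h0 u huU hu]
    · rw [indicator_of_notMem huU]

/-- Stokes' theorem in the plane, for functions with compact support. -/
theorem setIntegral_wd_eq_zero {U K : Set ℂ} {g : ℂ → ℂ} (hU : IsOpen U)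
    (hg : ContDiffOn ℝ ∞ g U) (hK : IsCompact K) (hKU : K ⊆ U) (h0 : ∀ z ∈ U, z ∉ K → g z = 0)
    (c : ℂ) : ∫ z in U, wd 1 Complex.I c g z = 0 := by
  have hG := contDiff_indicator hU hg hK hKU h0
  set G := U.indicator g with hGdef
  have hGs : HasCompactSupport G := HasCompactSupport.intro hK fun z hz => by
    by_cases hzU : z ∈ U
    · rw [hGdef, indicator_of_mem hzU, h0 z hzU hz]
    · rw [hGdef, indicator_of_notMem hzU]
  have hGd : Differentiable ℝ G := hG.differentiable (by simp)
  have hfd : ∀ v : ℂ, Integrable fun z => fderiv ℝ G z v := fun v =>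
    ((hG.continuous_fderiv (by simp)).clm_apply continuous_const).integrable_of_hasCompactSupport
      ((hGs.fderiv (𝕜 := ℝ)).comp_left (g := fun L : ℂ →L[ℝ] ℂ => L v) rfl)
  have hint : ∀ v : ℂ, ∫ z, fderiv ℝ G z v = 0 := fun v => by
    have := integral_mul_fderiv_eq_neg_fderiv_mul_of_integrable (𝕜 := ℂ) (μ := volume) (v := v)
      (f := fun _ : ℂ => (1 : ℂ)) (g := G) (by simp) (by simpa using hfd v)
      (by simpa using hG.continuous.integrable_of_hasCompactSupport hGs)
      (fun _ _ => differentiableAt_const _) fun x _ => hGd x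
    simpa using this
  have h1 : ∫ z in U, wd 1 Complex.I c g z = ∫ z in U, wd 1 Complex.I c G z :=
    setIntegral_congr_fun hU.measurableSet fun z hz => wd_congr (by
      filter_upwards [hU.mem_nhds hz] with u hu using (indicator_of_mem hu _).symm)
  rw [h1, setIntegral_eq_integral_of_forall_compl_eq_zero]
  · simp only [wd]
    rw [integral_const_mul, integral_add (hfd 1) ((hfd _).const_mul c), integral_const_mul, hint,
      hint]
    simp
  · intro z hz
    have : G =ᶠ[𝓝 z] fun _ => 0 := by
      filter_upwards [hK.isClosed.isOpen_compl.mem_nhds fun h => hz (hKU h)] with u hu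
      by_cases huU : u ∈ U
      · rw [hGdef, indicator_of_mem huU, h0 u huU hu]
      · rw [hGdef, indicator_of_notMem huU]
    rw [wd_congr this, wd_const]

/-- The real Jacobian determinant of multiplication by a complex number. -/
theorem det_toSpanSingleton (T : ℂ) :
    ((ContinuousLinearMap.toSpanSingleton ℂ T).restrictScalars ℝ).det = Complex.normSq T := by
  rw [← Algebra.norm_complex_apply, Algebra.norm_apply, ContinuousLinearMap.det]
  congr 1
  ext
  simp [mul_comm]

end Planar

section Charts

variable {X : Type*} [TopologicalSpace X] [ChartedSpace ℂ X]

theorem isCompact_chart_image {e : atlas ℂ X} {C : Set X} (hC : IsCompact C)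
    (hCe : C ⊆ e.1.source) : IsCompact (e.1 '' C) ∧ e.1 '' C ⊆ e.1.target :=
  ⟨hC.image_of_continuousOn (e.1.continuousOn.mono hCe),
    image_subset_iff.2 fun _ hx => e.1.map_source (hCe hx)⟩

theorem symm_notMem_of_notMem_image {e : atlas ℂ X} {C : Set X} {z : ℂ} (hz : z ∈ e.1.target)
    (h : z ∉ e.1 '' C) : e.1.symm z ∉ C :=
  fun h' => h ⟨_, h', e.1.right_inv hz⟩

variable [IsManifold 𝓘(ℂ, ℂ) ω X]

/-- The underlying real manifold of the surface is smooth. -/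
theorem isManifold_real : IsManifold 𝓘(ℝ, ℂ) ∞ X := by
  refine isManifold_of_contDiffOn 𝓘(ℝ, ℂ) ∞ X fun e e' he he' => ?_
  have h := ((contDiffOn_trans (⟨e, he⟩ : atlas ℂ X) ⟨e', he'⟩).of_le
    (m := ∞) (by simp)).restrict_scalars ℝ
  refine h.mono fun z hz => ?_
  simpa [overlap] using hz

end Charts

section Surface

open MeasureTheory

variable {X : Type*} [TopologicalSpace X] [ChartedSpace ℂ X] [T2Space X] [CompactSpace X]
  {η θ : atlas ℂ X → ℂ → ℂ}

theorem chartPartition_subordinate (e : atlas ℂ X) :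
    tsupport (chartPartition X e) ⊆ e.1.source :=
  Classical.choose_spec (exists_chartPartition X) e

theorem chartPartition_eq_zero {e : atlas ℂ X} {x : X} (hx : x ∉ e.1.source) :
    chartPartition X e x = 0 :=
  image_eq_zero_of_notMem_tsupport fun h => hx (chartPartition_subordinate e h)

theorem finite_chartPartition : {e : atlas ℂ X | chartPartition X e ≠ 0}.Finite := by
  refine ((chartPartition X).locallyFinite.finite_nonempty_of_compact).subset fun e he => ?_
  rw [mem_ofPred_eq, Function.support_nonempty_iff]
  intro h
  exact he (ContinuousMap.ext fun x => congrFun h x)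

theorem surfaceIntegral_eq_sum (η : atlas ℂ X → ℂ → ℂ) :
    surfaceIntegral η = ∑ e ∈ (finite_chartPartition (X := X)).toFinset,
      ∫ z in e.1.target, ((chartPartition X e (e.1.symm z) : ℝ) : ℂ) * η e z := by
  refine finsum_eq_sum_of_support_subset _ fun e he => ?_
  rw [Finite.coe_toFinset]
  intro h
  exact he (by simp [h])

theorem surfaceIntegral_congr (h : ∀ e : atlas ℂ X, ∀ z ∈ e.1.target, η e z = θ e z) :
    surfaceIntegral η = surfaceIntegral θ :=
  finsum_congr fun e => setIntegral_congr_fun e.1.open_target.measurableSet fun z hz => by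
    simp only [h e z hz]

theorem continuousOn_chartPartition_symm (e e' : atlas ℂ X) :
    ContinuousOn (fun z => ((chartPartition X e (e'.1.symm z) : ℝ) : ℂ)) e'.1.target :=
  Complex.continuous_ofReal.comp_continuousOn
    ((chartPartition X e).continuous.comp_continuousOn e'.1.continuousOn_symm)

theorem integrableOn_chartPartition_mul (hη : ∀ e : atlas ℂ X, ContinuousOn (η e) e.1.target)
    (e : atlas ℂ X) :
    IntegrableOn (fun z => ((chartPartition X e (e.1.symm z) : ℝ) : ℂ) * η e z) e.1.target := by
  have hC := isCompact_chart_image (isClosed_tsupport (chartPartition X e)).isCompact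
    (chartPartition_subordinate e)
  refine integrableOn_of_eq_zero_off_compact e.1.open_target
    ((continuousOn_chartPartition_symm e e).mul (hη e)) hC.1 hC.2 fun z hz hz' => ?_
  rw [image_eq_zero_of_notMem_tsupport (symm_notMem_of_notMem_image hz hz')]
  simp

theorem surfaceIntegral_sum {ι : Type*} (s : Finset ι) {η : ι → atlas ℂ X → ℂ → ℂ}
    (hη : ∀ i ∈ s, ∀ e : atlas ℂ X, ContinuousOn (η i e) e.1.target) :
    surfaceIntegral (fun e z => ∑ i ∈ s, η i e z) = ∑ i ∈ s, surfaceIntegral (η i) := by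
  simp only [surfaceIntegral_eq_sum]
  rw [Finset.sum_comm]
  refine Finset.sum_congr rfl fun e _ => ?_
  simp only [Finset.mul_sum]
  exact integral_finsetSum _ fun i hi => integrableOn_chartPartition_mul (hη i hi) e

theorem surfaceIntegral_add (hη : ∀ e : atlas ℂ X, ContinuousOn (η e) e.1.target)
    (hθ : ∀ e : atlas ℂ X, ContinuousOn (θ e) e.1.target) :
    surfaceIntegral (fun e z => η e z + θ e z) = surfaceIntegral η + surfaceIntegral θ := by
  simp only [surfaceIntegral_eq_sum]
  rw [← Finset.sum_add_distrib]
  refine Finset.sum_congr rfl fun e _ => ?_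
  simp only [mul_add]
  exact integral_add (integrableOn_chartPartition_mul hη e) (integrableOn_chartPartition_mul hθ e)

variable [IsManifold 𝓘(ℂ, ℂ) ω X]

/-- The integral of a form with support in one chart can be computed in that chart, by the change of
variables formula: a `(1,1)`-form transforms by the Jacobian determinant `|τ'|²`. -/
theorem surfaceIntegral_eq_setIntegral (hη : IsSection 1 1 η) (e₀ : atlas ℂ X) {C : Set X}
    (hC : IsCompact C) (hCe : C ⊆ e₀.1.source)
    (h0 : ∀ e : atlas ℂ X, ∀ z ∈ e.1.target, e.1.symm z ∉ C → η e z = 0) :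
    surfaceIntegral η = ∫ z in e₀.1.target, η e₀ z := by
  have hchange : ∀ e : atlas ℂ X,
      ∫ z in e.1.target, ((chartPartition X e (e.1.symm z) : ℝ) : ℂ) * η e z
        = ∫ z in e₀.1.target, ((chartPartition X e (e₀.1.symm z) : ℝ) : ℂ) * η e₀ z := by
    intro e
    -- The form vanishes outside `e₀`, the weight outside `e`: both integrals live on the overlap.
    have h1 : ∫ z in e.1.target, ((chartPartition X e (e.1.symm z) : ℝ) : ℂ) * η e z
        = ∫ z in overlap e e₀, ((chartPartition X e (e.1.symm z) : ℝ) : ℂ) * η e z := by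
      refine setIntegral_eq_of_subset_of_forall_sdiff_eq_zero e.1.open_target.measurableSet
        inter_subset_left fun z hz => ?_
      rw [h0 e z hz.1 fun h => hz.2 ⟨hz.1, hCe h⟩, mul_zero]
    have h2 : ∫ z in e₀.1.target, ((chartPartition X e (e₀.1.symm z) : ℝ) : ℂ) * η e₀ z
        = ∫ z in overlap e₀ e, ((chartPartition X e (e₀.1.symm z) : ℝ) : ℂ) * η e₀ z := by
      refine setIntegral_eq_of_subset_of_forall_sdiff_eq_zero e₀.1.open_target.measurableSet
        inter_subset_left fun z hz => ?_
      rw [chartPartition_eq_zero fun h => hz.2 ⟨hz.1, h⟩]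
      simp
    have him : trans e₀ e '' overlap e₀ e = overlap e e₀ := by
      ext z
      constructor
      · rintro ⟨u, hu, rfl⟩; exact trans_mem_overlap hu
      · exact fun hz => ⟨_, trans_mem_overlap hz, trans_trans hz⟩
    have hinj : InjOn (trans e₀ e) (overlap e₀ e) := fun u hu v hv h => by
      rw [← trans_trans hu, h, trans_trans hv]
    rw [h1, h2, ← him, integral_image_eq_integral_abs_det_fderiv_smul volume
      (isOpen_overlap e₀ e).measurableSet (fun u hu =>
        ((differentiableAt_trans hu).hasDerivAt.hasFDerivAt.restrictScalars ℝ).hasFDerivWithinAt)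
      hinj]
    refine setIntegral_congr_fun (isOpen_overlap e₀ e).measurableSet fun u hu => ?_
    simp only [det_toSpanSingleton, abs_of_nonneg (Complex.normSq_nonneg _), symm_trans hu,
      hη.2 e₀ e u hu, zpow_one, Complex.real_smul, ← Complex.mul_conj]
    ring
  have hC' := isCompact_chart_image hC hCe
  rw [surfaceIntegral_eq_sum, Finset.sum_congr rfl fun e _ => hchange e, ← integral_finsetSum]
  · refine setIntegral_congr_fun e₀.1.open_target.measurableSet fun z _ => ?_
    have h1 : ∑ e ∈ (finite_chartPartition (X := X)).toFinset,
        chartPartition X e (e₀.1.symm z) = 1 := by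
      rw [← (chartPartition X).sum_eq_one (mem_univ (e₀.1.symm z))]
      refine (finsum_eq_sum_of_support_subset _ fun e he => ?_).symm
      rw [Finite.coe_toFinset]
      intro h
      exact he (by simp [h])
    simp only [← Finset.sum_mul, ← Complex.ofReal_sum, h1, Complex.ofReal_one, one_mul]
  · intro e _
    refine integrableOn_of_eq_zero_off_compact e₀.1.open_target
      ((continuousOn_chartPartition_symm e e₀).mul (hη.1 e₀).continuousOn) hC'.1 hC'.2
      fun z hz hz' => ?_
    rw [h0 e₀ z hz (symm_notMem_of_notMem_image hz hz'), mul_zero]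

/-- A decomposition of the constant function `1` into smooth functions supported in charts. -/
theorem exists_smooth_partition : ∃ (s : Finset (atlas ℂ X)) (r : atlas ℂ X → X → ℝ),
    (∀ i, IsSection 0 0 fun e z => ((r i (e.1.symm z) : ℝ) : ℂ)) ∧
    (∀ i, tsupport (r i) ⊆ i.1.source) ∧ ∀ x, ∑ i ∈ s, r i x = 1 := by
  have := isManifold_real (X := X)
  obtain ⟨r, hr⟩ := SmoothPartitionOfUnity.exists_isSubordinate (M := X) 𝓘(ℝ, ℂ) isClosed_univ
    (fun e : atlas ℂ X => e.1.source) (fun e => e.1.open_source)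
    fun x _ => mem_iUnion.2 ⟨⟨chartAt ℂ x, chart_mem_atlas ℂ x⟩, mem_chart_source ℂ x⟩
  have hfin := r.locallyFinite.finite_nonempty_of_compact
  refine ⟨hfin.toFinset, fun i => r i, fun i => ⟨fun e => ?_, fun e e' z hz => ?_⟩, hr,
    fun x => ?_⟩
  · have h1 : ContMDiffOn 𝓘(ℝ, ℂ) 𝓘(ℝ, ℂ) ∞ e.1.symm e.1.target :=
      contMDiffOn_symm_of_mem_maximalAtlas (IsManifold.subset_maximalAtlas e.2)
    have h2 : ContDiffOn ℝ ∞ (fun z => r i (e.1.symm z)) e.1.target :=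
      contMDiffOn_iff_contDiffOn.1 ((r i).contMDiff.comp_contMDiffOn h1)
    exact Complex.ofRealCLM.contDiff.comp_contDiffOn h2
  · simp [symm_trans hz]
  · rw [← r.sum_eq_one (mem_univ x)]
    refine (finsum_eq_sum_of_support_subset _ fun e he => ?_).symm
    rw [Finite.coe_toFinset]
    exact ⟨x, he⟩

/-- Stokes' theorem for the operators `∂` and `∂̄` on `1`-forms. -/
theorem surfaceIntegral_wd_eq_zero {a b : ℤ} {α : atlas ℂ X → ℂ → ℂ} (hα : IsSection a b α) (c : ℂ)
    (hD : ∀ β : atlas ℂ X → ℂ → ℂ, IsSection a b β →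
      IsSection 1 1 fun e => wd 1 Complex.I c (β e)) :
    surfaceIntegral (fun e => wd 1 Complex.I c (α e)) = 0 := by
  obtain ⟨s, r, hr, hrs, hsum⟩ := exists_smooth_partition (X := X)
  have hrα : ∀ i, IsSection a b fun e z => ((r i (e.1.symm z) : ℝ) : ℂ) * α e z := fun i => by
    simpa using (hr i).mul hα
  have h1 : surfaceIntegral (fun e => wd 1 Complex.I c (α e))
      = surfaceIntegral fun e z => ∑ i ∈ s,
        wd 1 Complex.I c (fun z => ((r i (e.1.symm z) : ℝ) : ℂ) * α e z) z := by
    refine surfaceIntegral_congr fun e z hz => ?_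
    rw [← wd_sum s fun i _ => (hrα i).differentiableAt hz]
    congr 1
    funext z
    rw [← Finset.sum_mul, ← Complex.ofReal_sum, hsum, Complex.ofReal_one, one_mul]
  rw [h1, surfaceIntegral_sum s fun i _ e => ((hD _ (hrα i)).1 e).continuousOn]
  refine Finset.sum_eq_zero fun i _ => ?_
  have hC : IsCompact (tsupport (r i)) := (isClosed_tsupport _).isCompact
  have hC' := isCompact_chart_image hC (hrs i)
  rw [surfaceIntegral_eq_setIntegral (hD _ (hrα i)) i hC (hrs i) fun e z hz hz' => ?_]
  · refine setIntegral_wd_eq_zero i.1.open_target ((hrα i).1 i) hC'.1 hC'.2 (fun z hz hz' => ?_) c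
    beta_reduce
    rw [image_eq_zero_of_notMem_tsupport (symm_notMem_of_notMem_image hz hz')]
    simp
  · have hopen : IsOpen (e.1.target ∩ e.1.symm ⁻¹' (tsupport (r i))ᶜ) :=
      e.1.isOpen_inter_preimage_symm (isClosed_tsupport _).isOpen_compl
    have : (fun z => ((r i (e.1.symm z) : ℝ) : ℂ) * α e z) =ᶠ[𝓝 z] fun _ => 0 := by
      filter_upwards [hopen.mem_nhds ⟨hz, hz'⟩] with u hu
      rw [image_eq_zero_of_notMem_tsupport hu.2]
      simp
    rw [wd_congr this, wd_const]

theorem surfaceIntegral_dzbar_eq_zero {α : atlas ℂ X → ℂ → ℂ} (hα : IsSection 1 0 α) :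
    surfaceIntegral (fun e => dzbar (α e)) = 0 :=
  surfaceIntegral_wd_eq_zero hα Complex.I fun _ hβ => hβ.dzbar

theorem surfaceIntegral_dz_eq_zero {β : atlas ℂ X → ℂ → ℂ} (hβ : IsSection 0 1 β) :
    surfaceIntegral (fun e => dz (β e)) = 0 := by
  rw [dz_eq_wd]
  exact surfaceIntegral_wd_eq_zero hβ _ fun _ hβ => dz_eq_wd ▸ hβ.dz

end Surface

/-! ### Integration by parts in the pairing -/

section Pairing

variable {X : Type*} [TopologicalSpace X] [ChartedSpace ℂ X] {n : ℕ}

/-- The left-hand side of the `k`-th equation on `(μ, t)`. -/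
def equationLHS (μ : CompatibleStructure X n) (t : Covector X n) (k : ℕ) (e : atlas ℂ X) (z : ℂ) :
    ℂ :=
  (-dzbar (t.1 k e) z + μ.1 2 e z * dz (t.1 k e) z + k * dz (μ.1 2 e) z * t.1 k e z)
    + ∑ l ∈ Finset.Icc 1 (n - k),
      (((l : ℂ) + k) * dz (μ.1 (l + 2) e) z * t.1 (k + l) e z
        + ((l : ℂ) + 1) * μ.1 (l + 2) e z * dz (t.1 (k + l) e) z)

theorem equationLHS_eq (μ : CompatibleStructure X n) (t : Covector X n) (k : ℕ) (e : atlas ℂ X)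
    (z : ℂ) : equationLHS μ t k e z = -dzbar (t.1 k e) z + ∑ l ∈ Finset.range (n - k + 1),
      (((l : ℂ) + k) * dz (μ.1 (l + 2) e) z * t.1 (k + l) e z
        + ((l : ℂ) + 1) * μ.1 (l + 2) e z * dz (t.1 (k + l) e) z) := by
  have h : Finset.range (n - k + 1) = insert 0 (Finset.Icc 1 (n - k)) := by
    ext l; simp only [Finset.mem_range, Finset.mem_insert, Finset.mem_Icc]; omega
  rw [h, Finset.sum_insert (by simp), equationLHS]
  simp only [Nat.cast_zero, zero_add, add_zero]
  ring

/-- The primitive for `∂̄` in the integration by parts. -/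
def boundaryA (t : Covector X n) (w : ℕ → atlas ℂ X → ℂ → ℂ) (e : atlas ℂ X) (z : ℂ) : ℂ :=
  ∑ m ∈ Finset.Icc 2 n, t.1 m e z * w (m - 1) e z

/-- The primitive for `∂` in the integration by parts. -/
def boundaryB (μ : CompatibleStructure X n) (t : Covector X n) (w : ℕ → atlas ℂ X → ℂ → ℂ)
    (e : atlas ℂ X) (z : ℂ) : ℂ :=
  ∑ m ∈ Finset.Icc 2 n, ∑ l ∈ Finset.Icc 2 m,
    ((l : ℂ) - 1) * (μ.1 l e z * (t.1 m e z * w (m + 1 - l) e z))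

/-- The re-indexing by `m + 2 - l` and `l - 2` that turns the double sum over the variations `δμ_m`
into the double sum in the equations. -/
theorem sum_sum_reindex (n : ℕ) (f : ℕ → ℕ → ℂ) :
    ∑ m ∈ Finset.Icc 2 n, ∑ l ∈ Finset.Icc 2 m, f (m + 2 - l) (l - 2)
      = ∑ k ∈ Finset.Icc 2 n, ∑ l ∈ Finset.range (n - k + 1), f k l := by
  rw [Finset.sum_sigma', Finset.sum_sigma']
  refine Finset.sum_nbij' (fun x => ⟨x.1 + 2 - x.2, x.2 - 2⟩) (fun x => ⟨x.1 + x.2, x.2 + 2⟩)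
    ?_ ?_ ?_ ?_ fun _ _ => rfl
  · rintro ⟨m, l⟩ h
    simp only [Finset.mem_sigma, Finset.mem_Icc, Finset.mem_range] at h ⊢
    omega
  · rintro ⟨m, l⟩ h
    simp only [Finset.mem_sigma, Finset.mem_Icc, Finset.mem_range] at h ⊢
    omega
  · rintro ⟨m, l⟩ h
    simp only [Finset.mem_sigma, Finset.mem_Icc] at h
    simp only [Sigma.mk.injEq]
    exact ⟨by omega, heq_of_eq (by omega)⟩
  · rintro ⟨m, l⟩ h
    simp only [Finset.mem_sigma, Finset.mem_Icc] at h
    simp only [Sigma.mk.injEq]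
    exact ⟨by omega, heq_of_eq (by omega)⟩

/-- The pointwise form of the integration by parts: the two sides differ by the product rule for
`∂̄(t_m w_{m-1})` and `∂((l-1) μ_l t_m w_{m+1-l})`. -/
theorem sum_mul_variationFormula (μ : CompatibleStructure X n) (t : Covector X n)
    {w : ℕ → atlas ℂ X → ℂ → ℂ} (hw : ∀ k : ℕ, IsSection (-(k : ℤ)) 0 (w k)) {e : atlas ℂ X}
    {z : ℂ} (hz : z ∈ e.1.target) :
    ∑ m ∈ Finset.Icc 2 n, t.1 m e z * variationFormula μ w m e z
      = (∑ k ∈ Finset.Icc 2 n, w (k - 1) e z * equationLHS μ t k e z)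
        + (dzbar (boundaryA t w e) z + (-1) * dz (boundaryB μ t w e) z) := by
  have ht : ∀ k, DifferentiableAt ℝ (t.1 k e) z := fun k =>
    (IsSection.of_mem (t.2.1 k)).differentiableAt hz
  have hμ : ∀ k, DifferentiableAt ℝ (μ.1 k e) z := fun k =>
    (IsSection.of_mem (μ.2.1 k)).differentiableAt hz
  have hwd : ∀ k, DifferentiableAt ℝ (w k e) z := fun k => (hw k).differentiableAt hz
  have hA : dzbar (boundaryA t w e) z = ∑ m ∈ Finset.Icc 2 n,
      (t.1 m e z * dzbar (w (m - 1) e) z + w (m - 1) e z * dzbar (t.1 m e) z) := by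
    change wd 1 Complex.I Complex.I
      (fun z => ∑ m ∈ Finset.Icc 2 n, t.1 m e z * w (m - 1) e z) z = _
    rw [wd_sum _ fun m _ => (ht m).fun_mul (hwd _)]
    exact Finset.sum_congr rfl fun m _ => dzbar_mul (ht m) (hwd _)
  have hB : dz (boundaryB μ t w e) z = ∑ m ∈ Finset.Icc 2 n, ∑ l ∈ Finset.Icc 2 m,
      ((l : ℂ) - 1) * (μ.1 l e z * (t.1 m e z * dz (w (m + 1 - l) e) z
          + w (m + 1 - l) e z * dz (t.1 m e) z)
        + (t.1 m e z * w (m + 1 - l) e z) * dz (μ.1 l e) z) := by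
    have hd : ∀ m l, DifferentiableAt ℝ
        (fun z => μ.1 l e z * (t.1 m e z * w (m + 1 - l) e z)) z := fun m l =>
      (hμ l).fun_mul ((ht m).fun_mul (hwd _))
    rw [dz_eq_wd]
    change wd 1 Complex.I (-Complex.I) (fun z => ∑ m ∈ Finset.Icc 2 n, ∑ l ∈ Finset.Icc 2 m,
      ((l : ℂ) - 1) * (μ.1 l e z * (t.1 m e z * w (m + 1 - l) e z))) z = _
    rw [wd_sum _ fun m _ => DifferentiableAt.fun_sum fun l _ => (hd m l).const_mul _]
    refine Finset.sum_congr rfl fun m _ => ?_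
    rw [wd_sum _ fun l _ => (hd m l).const_mul _]
    refine Finset.sum_congr rfl fun l _ => ?_
    rw [wd_const_mul _ (hd m l), wd_mul (hμ l) ((ht m).fun_mul (hwd _)), wd_mul (ht m) (hwd _)]
  have hre := sum_sum_reindex n fun k l => w (k - 1) e z *
    (((l : ℂ) + k) * dz (μ.1 (l + 2) e) z * t.1 (k + l) e z
        + ((l : ℂ) + 1) * μ.1 (l + 2) e z * dz (t.1 (k + l) e) z)
  have hE : ∑ k ∈ Finset.Icc 2 n, w (k - 1) e z * equationLHS μ t k e z
      = (∑ k ∈ Finset.Icc 2 n, -(w (k - 1) e z * dzbar (t.1 k e) z))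
        + ∑ m ∈ Finset.Icc 2 n, ∑ l ∈ Finset.Icc 2 m, w (m + 1 - l) e z *
          ((m : ℂ) * dz (μ.1 l e) z * t.1 m e z
            + ((l : ℂ) - 1) * μ.1 l e z * dz (t.1 m e) z) := by
    have h1 : ∑ m ∈ Finset.Icc 2 n, ∑ l ∈ Finset.Icc 2 m, w (m + 1 - l) e z *
          ((m : ℂ) * dz (μ.1 l e) z * t.1 m e z
            + ((l : ℂ) - 1) * μ.1 l e z * dz (t.1 m e) z)
        = ∑ k ∈ Finset.Icc 2 n, ∑ l ∈ Finset.range (n - k + 1), w (k - 1) e z *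
          (((l : ℂ) + k) * dz (μ.1 (l + 2) e) z * t.1 (k + l) e z
            + ((l : ℂ) + 1) * μ.1 (l + 2) e z * dz (t.1 (k + l) e) z) := by
      rw [← hre]
      refine Finset.sum_congr rfl fun m _ => Finset.sum_congr rfl fun l hl => ?_
      rw [Finset.mem_Icc] at hl
      obtain ⟨L, rfl⟩ : ∃ L, l = L + 2 := ⟨l - 2, by omega⟩
      obtain ⟨r, rfl⟩ : ∃ r, m = L + 2 + r := ⟨m - (L + 2), by omega⟩
      have e1 : L + 2 + r + 1 - (L + 2) = r + 1 := by omega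
      have e2 : L + 2 + r + 2 - (L + 2) - 1 = r + 1 := by omega
      have e3 : L + 2 + r + 2 - (L + 2) = r + 2 := by omega
      have e4 : r + 2 + L = L + 2 + r := by omega
      simp only [e1, e3, Nat.add_sub_cancel, e4, show r + 2 - 1 = r + 1 by omega]
      push_cast
      ring
    rw [h1, ← Finset.sum_add_distrib]
    refine Finset.sum_congr rfl fun k _ => ?_
    rw [equationLHS_eq, mul_add, Finset.mul_sum]
    ring
  rw [hA, hB, hE, Finset.mul_sum, ← Finset.sum_add_distrib, ← Finset.sum_add_distrib,
    ← Finset.sum_add_distrib]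
  refine Finset.sum_congr rfl fun m _ => ?_
  rw [variationFormula, mul_add, Finset.mul_sum, Finset.mul_sum]
  have h2 : ∑ l ∈ Finset.Icc 2 m, t.1 m e z *
        (((m + 1 - l : ℕ) : ℂ) * w (m + 1 - l) e z * dz (μ.1 l e) z
          - ((l : ℂ) - 1) * μ.1 l e z * dz (w (m + 1 - l) e) z)
      = ∑ l ∈ Finset.Icc 2 m, w (m + 1 - l) e z *
          ((m : ℂ) * dz (μ.1 l e) z * t.1 m e z + ((l : ℂ) - 1) * μ.1 l e z * dz (t.1 m e) z)
        + ∑ l ∈ Finset.Icc 2 m, -1 * (((l : ℂ) - 1) * (μ.1 l e z *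
            (t.1 m e z * dz (w (m + 1 - l) e) z + w (m + 1 - l) e z * dz (t.1 m e) z)
          + (t.1 m e z * w (m + 1 - l) e z) * dz (μ.1 l e) z)) := by
    rw [← Finset.sum_add_distrib]
    refine Finset.sum_congr rfl fun l hl => ?_
    rw [Finset.mem_Icc] at hl
    push_cast [show l ≤ m + 1 by omega]
    ring
  rw [h2]
  ring

variable [IsManifold 𝓘(ℂ, ℂ) ω X]

theorem isSection_equationLHS (μ : CompatibleStructure X n) (t : Covector X n) (k : ℕ) :
    IsSection (k : ℤ) 1 (equationLHS μ t k) := by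
  have h : equationLHS μ t k = fun e z => (-1) * dzbar (t.1 k e) z
      + ∑ l ∈ Finset.range (n - k + 1),
        (((l : ℂ) + k) * dz (μ.1 (l + 2) e) z * t.1 (k + l) e z
          + ((l : ℂ) + 1) * μ.1 (l + 2) e z * dz (t.1 (k + l) e) z) := by
    funext e z
    rw [equationLHS_eq, neg_one_mul]
  rw [h]
  refine ((IsSection.of_mem (t.2.1 k)).dzbar.const_mul (-1)).add (IsSection.sum _ fun l _ => ?_)
  convert (IsSection.of_mem (t.2.1 (k + l))).bracket (IsSection.of_mem (μ.2.1 (l + 2))) using 1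
  · push_cast; ring
  · simp
  · funext e z
    push_cast
    ring

theorem isSection_boundaryA (t : Covector X n) {w : ℕ → atlas ℂ X → ℂ → ℂ}
    (hw : ∀ k : ℕ, IsSection (-(k : ℤ)) 0 (w k)) : IsSection 1 0 (boundaryA t w) := by
  refine IsSection.sum _ fun m hm => ?_
  rw [Finset.mem_Icc] at hm
  convert (IsSection.of_mem (t.2.1 m)).mul (hw (m - 1)) using 1
  · push_cast [show 1 ≤ m by omega]
    ring
  · simp

theorem isSection_boundaryB (μ : CompatibleStructure X n) (t : Covector X n)
    {w : ℕ → atlas ℂ X → ℂ → ℂ} (hw : ∀ k : ℕ, IsSection (-(k : ℤ)) 0 (w k)) :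
    IsSection 0 1 (boundaryB μ t w) := by
  refine IsSection.sum _ fun m _ => IsSection.sum _ fun l hl => ?_
  rw [Finset.mem_Icc] at hl
  refine IsSection.const_mul _ ?_
  convert (IsSection.of_mem (μ.2.1 l)).mul
    ((IsSection.of_mem (t.2.1 m)).mul (hw (m + 1 - l))) using 1
  · push_cast [show l ≤ m + 1 by omega]
    ring
  · simp

variable [T2Space X] [CompactSpace X]

/-- The pairing of `t` with the variation given by `w` is the pairing of `w` with the left-hand
sides of the equations. -/
theorem pairing_eq (μ : CompatibleStructure X n) (t : Covector X n)
    {w : ℕ → atlas ℂ X → ℂ → ℂ} (hw : ∀ k : ℕ, IsSection (-(k : ℤ)) 0 (w k)) (δ : Variation X n)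
    (hδ : ∀ m ∈ Finset.Icc 2 n, ∀ e : atlas ℂ X, ∀ z ∈ e.1.target,
      δ.1 m e z = variationFormula μ w m e z) :
    pairing t δ = surfaceIntegral fun e z =>
      ∑ k ∈ Finset.Icc 2 n, w (k - 1) e z * equationLHS μ t k e z := by
  have hA := isSection_boundaryA t hw
  have hB := isSection_boundaryB μ t hw
  have hE : ∀ e : atlas ℂ X, ContinuousOn
      (fun z => ∑ k ∈ Finset.Icc 2 n, w (k - 1) e z * equationLHS μ t k e z) e.1.target :=
    fun e => continuousOn_finsetSum _ fun k _ =>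
      ((hw _).1 e).continuousOn.mul ((isSection_equationLHS μ t k).1 e).continuousOn
  have hA' : ∀ e : atlas ℂ X, ContinuousOn (dzbar (boundaryA t w e)) e.1.target := fun e =>
    (hA.dzbar.1 e).continuousOn
  have hB' : ∀ e : atlas ℂ X, ContinuousOn (fun z => (-1) * dz (boundaryB μ t w e) z)
      e.1.target := fun e => ((hB.dz.const_mul (-1)).1 e).continuousOn
  have h0 : surfaceIntegral (fun e z => (-1) * dz (boundaryB μ t w e) z) = 0 := by
    have h := surfaceIntegral_dz_eq_zero (hB.const_mul (-1))
    rw [← h]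
    refine surfaceIntegral_congr fun e z hz => ?_
    rw [dz_eq_wd, wd_const_mul _ (hB.differentiableAt hz)]
  rw [pairing, surfaceIntegral_congr (θ := fun e z =>
    (∑ k ∈ Finset.Icc 2 n, w (k - 1) e z * equationLHS μ t k e z)
      + (dzbar (boundaryA t w e) z + (-1) * dz (boundaryB μ t w e) z)) fun e z hz => ?_,
    surfaceIntegral_add hE fun e => (hA' e).fun_add (hB' e), surfaceIntegral_add hA' hB', h0,
    surfaceIntegral_dzbar_eq_zero hA]
  · simp
  · rw [← sum_mul_variationFormula μ t hw hz]
    exact Finset.sum_congr rfl fun m hm => by rw [hδ m hm e z hz]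

theorem mem_cotangentSpace_of_equations (μ : CompatibleStructure X n) (t : Covector X n)
    (h : ∀ k ∈ Finset.Icc 2 n, ∀ e : atlas ℂ X, ∀ z ∈ e.1.target, equationLHS μ t k e z = 0) :
    t ∈ cotangentSpace μ := by
  intro H δ hH hδ
  rw [pairing_eq μ t (isSection_hamCoeff μ hH) δ ((isHamiltonianVariation_iff μ hH δ).1 hδ),
    surfaceIntegral_congr (θ := fun _ _ => 0) fun e z hz => ?_]
  · simp [surfaceIntegral]
  · exact Finset.sum_eq_zero fun k hk => by rw [h k hk e z hz, mul_zero]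

end Pairing

/-! ### Test Hamiltonians -/

section Jets

/-- Complex conjugation exchanges the two indices of a Taylor coefficient. -/
theorem jet_conj {g : ℂ → ℂ} (hg : ContDiff ℝ ∞ g) (a b : ℕ) :
    jet a b (fun p => starRingEnd ℂ (g p)) = starRingEnd ℂ (jet b a g) := by
  have h1 : ∀ (b : ℕ) {g : ℂ → ℂ}, ContDiff ℝ ∞ g →
      dzbar^[b] (fun p => starRingEnd ℂ (g p)) = (fun p => starRingEnd ℂ (dz^[b] g p)) ∧
      dz^[b] (fun p => starRingEnd ℂ (g p)) = fun p => starRingEnd ℂ (dzbar^[b] g p) := by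
    intro b g hg
    induction b with
    | zero => exact ⟨rfl, rfl⟩
    | succ b ih =>
      simp only [Function.iterate_succ_apply', ih.1, ih.2]
      refine ⟨funext fun p => (dz_conj ?_).2, funext fun p => (dz_conj ?_).1⟩
      · rw [dz_eq_wd]; exact (contDiff_wd_iterate hg b).differentiable (by simp) p
      · rw [dzbar_eq_wd]; exact (contDiff_wd_iterate hg b).differentiable (by simp) p
  have h2 : dzbar^[a] (dz^[b] g) = dz^[b] (dzbar^[a] g) := by
    induction a with
    | zero => rfl
    | succ a ih =>
      rw [Function.iterate_succ_apply', ih, Function.iterate_succ_apply', dz_eq_wd, dzbar_eq_wd]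
      funext x
      exact (wd_iterate_comm isOpen_univ (contDiff_wd_iterate hg a).contDiffOn b
        (mem_univ x)).symm
  have hb : ContDiff ℝ ∞ (dz^[b] g) := by rw [dz_eq_wd]; exact contDiff_wd_iterate hg b
  rw [jet, (h1 b hg).1, (h1 a hb).2, h2, jet]
  simp only [map_div₀, map_mul, Complex.conj_natCast]
  rw [mul_comm (b.factorial : ℂ)]

theorem jet_pow (k a b : ℕ) : jet a b (fun p => p ^ k) = if a = k ∧ b = 0 then 1 else 0 := by
  have h0 : ∀ a b, jet a b (fun _ => (0 : ℂ)) = 0 := fun a b => by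
    have := jet_const_mul (g := fun _ => (0 : ℂ)) contDiff_const 0 a b
    simpa using this
  induction k generalizing a with
  | zero =>
    simp only [pow_zero]
    have hc : ContDiff ℝ ∞ (fun _ : ℂ => (1 : ℂ)) := contDiff_const
    rcases a with _ | a
    · rcases b with _ | b
      · simp [jet]
      · have h1 := jet_dzbar (g := fun _ => (1 : ℂ)) 0 b
        have h2 : dzbar (fun _ => (1 : ℂ)) = fun _ => 0 := funext fun p => by
          rw [dzbar_eq_wd, wd_const]
        rw [h2, h0] at h1
        simpa [Nat.cast_add_one_ne_zero b] using h1.symm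
    · have h1 := jet_dz hc a b
      have h2 : dz (fun _ => (1 : ℂ)) = fun _ => 0 := funext fun p => by
        rw [dz_eq_wd, wd_const]
      rw [h2, h0] at h1
      simpa [Nat.cast_add_one_ne_zero a] using h1.symm
  | succ k ih =>
    have hs : ContDiff ℝ ∞ (fun p : ℂ => p ^ k) := by fun_prop
    have e : (fun p : ℂ => p ^ (k + 1)) = fun p => p * p ^ k := funext fun p => pow_succ' p k
    rw [e]
    rcases a with _ | a
    · rw [jet_zero_id_mul hs]; simp
    · rw [jet_succ_id_mul hs, ih]; simp

/-- The reduction of `2 Re (s p^k)`. -/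
theorem red_two_re (N k : ℕ) (hk : k < N) (M : ℂ[X]) (s : ℂ) :
    red N M (fun p => s * p ^ k + starRingEnd ℂ (s * p ^ k))
      = C s * X ^ k + C (starRingEnd ℂ s) * M ^ k := by
  have hs : ContDiff ℝ ∞ (fun p : ℂ => p ^ k) := by fun_prop
  have hsc : ContDiff ℝ ∞ (fun p : ℂ => starRingEnd ℂ (p ^ k)) :=
    Complex.conjCLE.contDiff.comp hs
  simp only [map_mul]
  rw [red_add (contDiff_const.mul hs) (contDiff_const.mul hsc), red_const_mul hs,
    red_const_mul hsc]
  have hk' : k ∈ Finset.range N := Finset.mem_range.2 hk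
  have h0' : 0 ∈ Finset.range N := Finset.mem_range.2 (by omega)
  congr 2
  · rw [red, Finset.sum_eq_single_of_mem k hk', Finset.sum_eq_single_of_mem 0 h0']
    · simp [jet_pow]
    · intro b _ hb; simp [jet_pow, hb]
    · intro a _ ha
      exact Finset.sum_eq_zero fun b _ => by simp [jet_pow, ha]
  · rw [red, Finset.sum_eq_single_of_mem 0 h0', Finset.sum_eq_single_of_mem k hk']
    · rw [jet_conj hs]; simp [jet_pow]
    · intro b _ hb
      rw [jet_conj hs]; simp [jet_pow, hb]
    · intro a _ ha
      exact Finset.sum_eq_zero fun b _ => by rw [jet_conj hs]; simp [jet_pow, ha]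

end Jets

section Test

variable {X : Type*} [TopologicalSpace X] [ChartedSpace ℂ X]

/-- A real covector, with the tangent space read as `ℂ`. -/
def covForm (ξ : RealCotangent X) : ℂ →L[ℝ] ℝ := ξ.2

/-- The complex number `q` for which a real covector is `2 Re (q ·)`. -/
def covCoord (ξ : RealCotangent X) : ℂ :=
  ((covForm ξ 1 : ℝ) - Complex.I * (covForm ξ Complex.I : ℝ)) / 2

theorem covCoord_stdCovector (x : X) (q : ℂ) : covCoord (stdCovector x q) = q := by
  apply Complex.ext <;> simp [covCoord, covForm, stdCovector]

theorem covCoord_of_mem_zeroSection {ξ : RealCotangent X} (h : ξ ∈ zeroSection X) :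
    covCoord ξ = 0 := by
  have h1 : covForm ξ = 0 := h
  simp [covCoord, h1]

/-- The preferred chart at a point. -/
def preferredChart (x : X) : atlas ℂ X := ⟨chartAt ℂ x, chart_mem_atlas ℂ x⟩

/-- The Hamiltonian `2 Re (s p^k)` of a section `s` of `K^{-k}`. -/
def testHam (k : ℕ) (s : atlas ℂ X → ℂ → ℂ) (ξ : RealCotangent X) : ℝ :=
  2 * (s (preferredChart ξ.1) ((preferredChart ξ.1).1 ξ.1)
    * (covCoord ξ / chartDeriv (preferredChart ξ.1) ξ.1) ^ k).re

/-- The section of `K^a` that reads `g` in the chart `e₀`, extended by zero. -/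
def bumpSection (a : ℤ) (e₀ : atlas ℂ X) (g : ℂ → ℂ) (e : atlas ℂ X) : ℂ → ℂ :=
  (overlap e e₀).indicator fun z => g (trans e e₀ z) * deriv (trans e e₀) z ^ a

theorem bumpSection_self (a : ℤ) (e₀ : atlas ℂ X) (g : ℂ → ℂ) {z : ℂ} (hz : z ∈ e₀.1.target) :
    bumpSection a e₀ g e₀ z = g z := by
  have hov : ∀ u ∈ e₀.1.target, u ∈ overlap e₀ e₀ := fun u hu => ⟨hu, e₀.1.map_target hu⟩
  have h1 : trans e₀ e₀ =ᶠ[𝓝 z] id := by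
    filter_upwards [e₀.1.open_target.mem_nhds hz] with u hu using e₀.1.right_inv hu
  rw [bumpSection, indicator_of_mem (hov z hz), h1.deriv_eq, h1.eq_of_nhds]
  simp

theorem bumpSection_eq_zero (a : ℤ) {e₀ e : atlas ℂ X} {K : Set ℂ} {g : ℂ → ℂ}
    (hg : ∀ z ∉ K, g z = 0) {z : ℂ} (hz' : e.1.symm z ∉ e₀.1.symm '' K) :
    bumpSection a e₀ g e z = 0 := by
  by_cases h : z ∈ overlap e e₀
  · rw [bumpSection, indicator_of_mem h, hg _ fun hK => hz' ⟨_, hK, symm_trans h⟩, zero_mul]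
  · exact indicator_of_notMem h _

theorem isCompact_symm_image {e₀ : atlas ℂ X} {K : Set ℂ} (hK : IsCompact K)
    (hKe : K ⊆ e₀.1.target) :
    IsCompact (e₀.1.symm '' K) ∧ e₀.1.symm '' K ⊆ e₀.1.source :=
  ⟨hK.image_of_continuousOn (e₀.1.continuousOn_symm.mono hKe),
    image_subset_iff.2 fun _ hx => e₀.1.map_target (hKe hx)⟩

variable [IsManifold 𝓘(ℂ, ℂ) ω X]

theorem chartDeriv_ne_zero {e : atlas ℂ X} {x : X} (hx : x ∈ e.1.source) :
    chartDeriv e x ≠ 0 := by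
  have : IsManifold 𝓘(ℂ, ℂ) 1 X := IsManifold.of_le (n := ω) (by simp)
  intro h
  have hb := ((mdifferentiable_of_mem_atlas (I := 𝓘(ℂ, ℂ)) e.2).mfderiv_bijective hx).1
  have hinj : Function.Injective (chartLin e x) := hb
  exact one_ne_zero (hinj (h.trans (map_zero (chartLin e x)).symm))

theorem testHam_covectorAt {k : ℕ} {s : atlas ℂ X → ℂ → ℂ} (hs : IsSection (-(k : ℤ)) 0 s)
    {e : atlas ℂ X} {z : ℂ} (hz : z ∈ e.1.target) (p : ℂ) :
    testHam k s (covectorAt e z p) = 2 * (s e z * p ^ k).re := by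
  set c := preferredChart (e.1.symm z) with hc
  have hx : e.1.symm z ∈ c.1.source := mem_chart_source ℂ _
  have hov : z ∈ overlap e c := ⟨hz, hx⟩
  have hT := deriv_trans_ne_zero hov
  have hD := chartDeriv_ne_zero hx
  have h1 : covectorAt e z p
      = stdCovector (e.1.symm z) ((deriv (trans e c) z)⁻¹ * p * chartDeriv c (e.1.symm z)) := by
    rw [covectorAt_trans hov, ← covectorAt_apply hx]
    rfl
  rw [h1, testHam, covCoord_stdCovector]
  change 2 * (s c (trans e c z) * _).re = _
  rw [hs.2 e c z hov]
  simp only [zpow_zero, mul_one, zpow_neg, zpow_natCast]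
  congr 2
  change s c (trans e c z) * ((deriv (trans e c) z)⁻¹ * p * chartDeriv c (e.1.symm z)
    / chartDeriv c (e.1.symm z)) ^ k = _
  rw [mul_div_cancel_right₀ _ hD, mul_pow, inv_pow]
  ring

theorem localHam_testHam {k : ℕ} {s : atlas ℂ X → ℂ → ℂ} (hs : IsSection (-(k : ℤ)) 0 s)
    {e : atlas ℂ X} {z : ℂ} (hz : z ∈ e.1.target) (p : ℂ) :
    localHam (testHam k s) e (z, p) = s e z * p ^ k + starRingEnd ℂ (s e z * p ^ k) := by
  rw [localHam, testHam_covectorAt hs hz, Complex.add_conj]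

theorem isHigherHamiltonian_testHam {k : ℕ} (hk : k ≠ 0) {s : atlas ℂ X → ℂ → ℂ}
    (hs : IsSection (-(k : ℤ)) 0 s) : IsHigherHamiltonian (testHam k s) := by
  refine ⟨fun e => ?_, fun ξ hξ => ?_⟩
  · have h1 : ContDiffOn ℝ ∞ (fun q : ℂ × ℂ => s e q.1 * q.2 ^ k) (e.1.target ×ˢ univ) := by
      refine ((hs.1 e).comp contDiffOn_fst fun q hq => hq.1).mul ?_
      fun_prop
    exact (h1.add (Complex.conjCLE.contDiff.comp_contDiffOn h1)).congr fun q hq =>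
      localHam_testHam hs hq.1 q.2
  · rw [testHam, covCoord_of_mem_zeroSection hξ]
    simp [hk]

/-- The reduction of `2 Re (s p^k)` modulo the ideal starts with
`s + s̄ [p^k] (μ₂ p + ⋯ + μ_n p^{n-1})^k` in degree `k`. -/
theorem hamCoeff_testHam {n k j : ℕ} (hk : k ≤ n) (hj : j ≤ k) (μ : CompatibleStructure X n)
    {s : atlas ℂ X → ℂ → ℂ} (hs : IsSection (-(k : ℤ)) 0 s) {e : atlas ℂ X} {z : ℂ}
    (hz : z ∈ e.1.target) :
    hamCoeff μ (testHam k s) j e z = if j = k then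
      s e z + starRingEnd ℂ (s e z) * ((genPoly n fun k => μ.1 k e z) ^ k).coeff k else 0 := by
  rw [hamCoeff, redCoeff, show (fun p => localHam (testHam k s) e (z, p)) = _ from
    funext fun p => localHam_testHam hs hz p, red_two_re _ _ (by omega), coeff_add, coeff_C_mul,
    coeff_C_mul, coeff_X_pow]
  split_ifs with h
  · rw [h, mul_one]
  · have := coeff_X_pow_mul_pow_eq_zero (X_dvd_genPoly n fun k => μ.1 k e z) (a := 0) (b := k)
      (j := j) (by omega)
    rw [pow_zero, one_mul] at this
    rw [this]
    simp

/-- The cocycle condition for changes of coordinates and their derivatives. -/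
theorem deriv_trans_comp {e e' e₀ : atlas ℂ X} {z : ℂ} (hz : z ∈ overlap e e')
    (hz₀ : z ∈ overlap e e₀) :
    trans e' e₀ (trans e e' z) = trans e e₀ z ∧ trans e e' z ∈ overlap e' e₀ ∧
    deriv (trans e e₀) z = deriv (trans e' e₀) (trans e e' z) * deriv (trans e e') z := by
  have hval : ∀ u ∈ overlap e e', trans e' e₀ (trans e e' u) = trans e e₀ u := fun u hu => by
    rw [trans, symm_trans hu]; rfl
  have hmem : trans e e' z ∈ overlap e' e₀ := ⟨(trans_mem_overlap hz).1, by
    rw [mem_preimage, symm_trans hz]; exact hz₀.2⟩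
  refine ⟨hval z hz, hmem, ?_⟩
  have h1 := (differentiableAt_trans hmem).hasDerivAt.comp z (differentiableAt_trans hz).hasDerivAt
  have h2 : trans e' e₀ ∘ trans e e' =ᶠ[𝓝 z] trans e e₀ := by
    filter_upwards [(isOpen_overlap e e').mem_nhds hz] with u hu using hval u hu
  exact (h1.congr_of_eventuallyEq h2.symm).deriv

theorem isSection_bumpSection [T2Space X] (a : ℤ) (e₀ : atlas ℂ X) {K : Set ℂ} (hK : IsCompact K)
    (hKe : K ⊆ e₀.1.target) {g : ℂ → ℂ} (hgs : ContDiff ℝ ∞ g) (hg : ∀ z ∉ K, g z = 0) :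
    IsSection a 0 (bumpSection a e₀ g) := by
  have hC := isCompact_symm_image hK hKe
  refine ⟨fun e z hz => ContDiffAt.contDiffWithinAt ?_, fun e e' z hz => ?_⟩
  · by_cases h : z ∈ overlap e e₀
    · have hmem := (isOpen_overlap e e₀).mem_nhds h
      have h1 : ContDiffAt ℝ ∞ (trans e e₀) z :=
        (((contDiffOn_trans e e₀).contDiffAt hmem).of_le (by simp)).restrict_scalars ℝ
      have h2 : ContDiffAt ℂ ∞ (deriv (trans e e₀)) z :=
        (contDiffOn_deriv_trans e e₀).contDiffAt hmem
      have h3 : ContDiffAt ℂ ∞ (fun u => deriv (trans e e₀) u ^ a) z := by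
        have hT := deriv_trans_ne_zero h
        rcases a with k | k
        · simpa using h2.pow k
        · simp only [zpow_negSucc]
          exact (h2.pow (k + 1)).inv (pow_ne_zero _ hT)
      refine ((hgs.contDiffAt.comp z h1).mul (h3.restrict_scalars ℝ)).congr_of_eventuallyEq ?_
      filter_upwards [hmem] with u hu
      exact indicator_of_mem hu _
    · have hopen : IsOpen (e.1.target ∩ e.1.symm ⁻¹' (e₀.1.symm '' K)ᶜ) :=
        e.1.isOpen_inter_preimage_symm hC.1.isClosed.isOpen_compl
      refine (contDiffAt_const (c := (0 : ℂ))).congr_of_eventuallyEq ?_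
      filter_upwards [hopen.mem_nhds ⟨hz, fun hzC => h ⟨hz, hC.2 hzC⟩⟩] with u hu
      exact bumpSection_eq_zero a hg hu.2
  · rw [zpow_zero, mul_one]
    by_cases h : z ∈ overlap e e₀
    · obtain ⟨h1, h2, h3⟩ := deriv_trans_comp hz h
      rw [bumpSection, bumpSection, indicator_of_mem h, indicator_of_mem h2, h1, h3, mul_zpow,
        mul_assoc]
    · have h2 : trans e e' z ∉ overlap e' e₀ := fun h' => h ⟨hz.1, by
        rw [mem_preimage, ← symm_trans hz]; exact h'.2⟩
      rw [bumpSection, bumpSection, indicator_of_notMem h, indicator_of_notMem h2, zero_mul]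

end Test

/-! ### Cotangent vectors satisfy the equations -/

section Converse

open MeasureTheory

variable {X : Type*} [TopologicalSpace X] [ChartedSpace ℂ X] [IsManifold 𝓘(ℂ, ℂ) ω X]
  [T2Space X] [CompactSpace X] {n : ℕ}

/-- The condition obtained by testing a cotangent vector on `2 Re (s p^{k-1})`, with `s` supported
in one chart, once the equations of higher index hold. -/
theorem setIntegral_test_eq_zero {μ : CompatibleStructure X n} {t : Covector X n}
    (ht : t ∈ cotangentSpace μ) {k : ℕ} (hk : k ∈ Finset.Icc 2 n)
    (hE : ∀ k' ∈ Finset.Icc 2 n, k < k' → ∀ e : atlas ℂ X, ∀ z ∈ e.1.target,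
      equationLHS μ t k' e z = 0)
    (e₀ : atlas ℂ X) {K : Set ℂ} (hK : IsCompact K) (hKe : K ⊆ e₀.1.target) {g : ℂ → ℂ}
    (hgs : ContDiff ℝ ∞ g) (hg : ∀ z ∉ K, g z = 0) :
    ∫ z in e₀.1.target, (g z + starRingEnd ℂ (g z)
      * ((genPoly n fun k => μ.1 k e₀ z) ^ (k - 1)).coeff (k - 1)) * equationLHS μ t k e₀ z
      = 0 := by
  have hk' := Finset.mem_Icc.1 hk
  set s := bumpSection (-((k - 1 : ℕ) : ℤ)) e₀ g with hs_def
  have hs : IsSection (-((k - 1 : ℕ) : ℤ)) 0 s := isSection_bumpSection _ e₀ hK hKe hgs hg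
  have hH : IsHigherHamiltonian (testHam (k - 1) s) :=
    isHigherHamiltonian_testHam (by omega) hs
  obtain ⟨δ, hδ⟩ := exists_isHamiltonianVariation μ hH
  have h0 := ht _ δ hH hδ
  have hw := isSection_hamCoeff μ hH
  have hwk := fun (j : ℕ) (hj : j ≤ k - 1) (e : atlas ℂ X) (z : ℂ) (hz : z ∈ e.1.target) =>
    hamCoeff_testHam (j := j) (by omega) hj μ hs hz
  rw [pairing_eq μ t hw δ ((isHamiltonianVariation_iff μ hH δ).1 hδ),
    surfaceIntegral_congr (θ := fun e z => hamCoeff μ (testHam (k - 1) s) (k - 1) e z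
      * equationLHS μ t k e z) fun e z hz => ?_] at h0
  · have hsec : IsSection 1 1 fun e z => hamCoeff μ (testHam (k - 1) s) (k - 1) e z
        * equationLHS μ t k e z := by
      convert (hw (k - 1)).mul (isSection_equationLHS μ t k) using 1
      · push_cast [show 1 ≤ k by omega]
        ring
      · simp
    have hC := isCompact_symm_image hK hKe
    rw [surfaceIntegral_eq_setIntegral hsec e₀ hC.1 hC.2 fun e z hz hz' => ?_] at h0
    · rw [← h0]
      refine setIntegral_congr_fun e₀.1.open_target.measurableSet fun z hz => ?_
      rw [hwk (k - 1) le_rfl e₀ z hz, if_pos rfl, hs_def, bumpSection_self _ e₀ g hz]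
    · rw [hwk (k - 1) le_rfl e z hz, if_pos rfl, hs_def, bumpSection_eq_zero _ hg hz']
      simp
  · refine Finset.sum_eq_single_of_mem k hk fun k' hk'' hne => ?_
    rcases lt_or_gt_of_ne hne with h | h
    · have := Finset.mem_Icc.1 hk''
      rw [hwk (k' - 1) (by omega) e z hz, if_neg (by omega), zero_mul]
    · rw [hE k' hk'' h e z hz, mul_zero]

/-- A cotangent vector satisfies the equations: this follows by descending induction on the index,
testing with `s = g` and `s = i g` for real bump functions `g`. -/
theorem equations_of_mem_cotangentSpace {μ : CompatibleStructure X n} {t : Covector X n}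
    (ht : t ∈ cotangentSpace μ) : ∀ k ∈ Finset.Icc 2 n, ∀ e : atlas ℂ X, ∀ z ∈ e.1.target,
      equationLHS μ t k e z = 0 := by
  suffices h : ∀ d k, n - k = d → k ∈ Finset.Icc 2 n → ∀ e : atlas ℂ X, ∀ z ∈ e.1.target,
      equationLHS μ t k e z = 0 from fun k hk => h _ k rfl hk
  intro d
  induction d using Nat.strong_induction_on with
  | _ d ih =>
    intro k hd hk e
    have hE : ∀ k' ∈ Finset.Icc 2 n, k < k' → ∀ e : atlas ℂ X, ∀ z ∈ e.1.target,
        equationLHS μ t k' e z = 0 := fun k' hk' hlt => by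
      have := Finset.mem_Icc.1 hk'
      exact ih (n - k') (by omega) k' rfl hk'
    have hcont : ContinuousOn (equationLHS μ t k e) e.1.target :=
      ((isSection_equationLHS μ t k).1 e).continuousOn
    have hmcont : ContinuousOn
        (fun z => ((genPoly n fun k => μ.1 k e z) ^ (k - 1)).coeff (k - 1)) e.1.target :=
      ((isSection_coeff_genPoly_pow μ (k - 1) (k - 1)).1 e).continuousOn
    have hae := e.1.open_target.ae_eq_zero_of_integral_contDiff_smul_eq_zero (μ := volume)
      (hcont.locallyIntegrableOn e.1.open_target.measurableSet) fun g hg hgc hgU => by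
        have hgs : ContDiff ℝ ∞ fun z => ((g z : ℝ) : ℂ) := Complex.ofRealCLM.contDiff.comp hg
        have hg0 : ∀ z ∉ tsupport g, ((g z : ℝ) : ℂ) = 0 := fun z hz => by
          rw [image_eq_zero_of_notMem_tsupport hz, Complex.ofReal_zero]
        have h1 := setIntegral_test_eq_zero ht hk hE e hgc hgU hgs hg0
        have h2 := setIntegral_test_eq_zero ht hk hE e hgc hgU
          (contDiff_const.mul hgs : ContDiff ℝ ∞ fun z => Complex.I * ((g z : ℝ) : ℂ))
          fun z hz => by rw [hg0 z hz, mul_zero]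
        have hi : ∀ F : ℂ → ℂ, ContinuousOn F e.1.target →
            IntegrableOn (fun z => ((g z : ℝ) : ℂ) * F z) e.1.target := fun F hF =>
          integrableOn_of_eq_zero_off_compact e.1.open_target
            (hgs.continuous.continuousOn.mul hF) hgc hgU fun z _ hz => by
              rw [hg0 z hz, zero_mul]
        have i1 := hi _ hcont
        have i2 := hi _ (hmcont.fun_mul hcont)
        have e1 : ∀ z, (((g z : ℝ) : ℂ) + starRingEnd ℂ ((g z : ℝ) : ℂ)
            * ((genPoly n fun k => μ.1 k e z) ^ (k - 1)).coeff (k - 1)) * equationLHS μ t k e z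
            = ((g z : ℝ) : ℂ) * equationLHS μ t k e z + ((g z : ℝ) : ℂ)
              * (((genPoly n fun k => μ.1 k e z) ^ (k - 1)).coeff (k - 1)
                * equationLHS μ t k e z) := fun z => by
          rw [Complex.conj_ofReal]; ring
        have e2 : ∀ z, (Complex.I * ((g z : ℝ) : ℂ)
            + starRingEnd ℂ (Complex.I * ((g z : ℝ) : ℂ))
              * ((genPoly n fun k => μ.1 k e z) ^ (k - 1)).coeff (k - 1)) * equationLHS μ t k e z
            = Complex.I * (((g z : ℝ) : ℂ) * equationLHS μ t k e z - ((g z : ℝ) : ℂ)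
              * (((genPoly n fun k => μ.1 k e z) ^ (k - 1)).coeff (k - 1)
                * equationLHS μ t k e z)) := fun z => by
          rw [map_mul, Complex.conj_ofReal, Complex.conj_I]; ring
        simp only [e1] at h1
        simp only [e2] at h2
        rw [integral_add i1 i2] at h1
        rw [integral_const_mul, integral_sub i1 i2] at h2
        -- `h1` and `h3` have opposite signs in front of the contribution of `s̄`.
        have h3 := (mul_eq_zero.1 h2).resolve_left Complex.I_ne_zero
        have h4 : ∫ z in e.1.target, ((g z : ℝ) : ℂ) * equationLHS μ t k e z = 0 := by
          linear_combination (1 / 2) * h1 + (1 / 2) * h3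
        rw [← h4, setIntegral_eq_integral_of_forall_compl_eq_zero fun z hz => ?_]
        · simp only [Complex.real_smul]
        · rw [hg0 z fun h => hz (hgU h), zero_mul]
    have hres : equationLHS μ t k e =ᵐ[volume.restrict e.1.target] fun _ => 0 :=
      (ae_restrict_iff' e.1.open_target.measurableSet).2 hae
    exact Measure.eqOn_open_of_ae_eq hres e.1.open_target hcont continuousOn_const

end Converse

/-! ### Consequences -/

section Consequences

variable {X : Type*} [TopologicalSpace X] [ChartedSpace ℂ X] [T2Space X] [CompactSpace X] {n : ℕ}

theorem cotangentPairs_eq_solutionPairs [IsManifold 𝓘(ℂ, ℂ) ω X] :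
    cotangentPairs X n = solutionPairs X n :=
  Set.ext fun q => ⟨fun h => equations_of_mem_cotangentSpace h, fun h =>
    mem_cotangentSpace_of_equations q.1 q.2 h⟩

theorem exists_equiv_modHigherDiffeos {S T : Set (CompatibleStructure X n × Covector X n)}
    (h : S = T) : ∃ Ψ : ModHigherDiffeos S ≃ ModHigherDiffeos T,
      (∀ q (hS : q ∈ S) (hT : q ∈ T),
        Ψ (ModHigherDiffeos.mk ⟨q, hS⟩) = ModHigherDiffeos.mk ⟨q, hT⟩) ∧
      ∀ a, ModHigherDiffeos.proj (Ψ a) = ModHigherDiffeos.proj a := by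
  subst h
  exact ⟨Equiv.refl _, fun _ _ _ => rfl, fun _ => rfl⟩

/-- For real differentiable functions, `∂̄f = 0` is the Cauchy-Riemann equation. -/
theorem differentiableAt_iff_dzbar_eq_zero {f : ℂ → ℂ} {z : ℂ} (hf : DifferentiableAt ℝ f z) :
    DifferentiableAt ℂ f z ↔ dzbar f z = 0 := by
  refine ⟨fun h => (dz_of_holomorphic h).2, fun h => ?_⟩
  rw [differentiableAt_complex_iff_differentiableAt_real]
  refine ⟨hf, ?_⟩
  rw [fderiv_eq_dz_add_dzbar, fderiv_eq_dz_add_dzbar, h, smul_eq_mul]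
  ring

theorem mem_cotangentSpace_zero_iff [IsManifold 𝓘(ℂ, ℂ) ω X] (μ : CompatibleStructure X n)
    (t : Covector X n) (hμ : ∀ k, μ.1 k = 0) :
    t ∈ cotangentSpace μ ↔
      ∀ k ∈ Finset.Icc 2 n, ∀ e : atlas ℂ X, DifferentiableOn ℂ (t.1 k e) e.1.target := by
  have h1 : t ∈ cotangentSpace μ ↔ ∀ k ∈ Finset.Icc 2 n, ∀ e : atlas ℂ X, ∀ z ∈ e.1.target,
      equationLHS μ t k e z = 0 :=
    ⟨equations_of_mem_cotangentSpace, mem_cotangentSpace_of_equations μ t⟩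
  have h2 : ∀ k e z, equationLHS μ t k e z = -dzbar (t.1 k e) z := fun k e z => by
    have : ∀ z : ℂ, dz (0 : ℂ → ℂ) z = 0 := fun z => by
      rw [dz_eq_wd]; exact wd_const 0
    simp [equationLHS, hμ, this]
  rw [h1]
  refine forall_congr' fun k => forall_congr' fun _ => forall_congr' fun e => ?_
  refine forall_congr' fun z => forall_congr' fun hz => ?_
  rw [h2, neg_eq_zero, ← differentiableAt_iff_dzbar_eq_zero
    ((IsSection.of_mem (t.2.1 k)).differentiableAt hz)]
  exact ⟨fun h => h.differentiableWithinAt, fun h =>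
    h.differentiableAt (e.1.open_target.mem_nhds hz)⟩

end Consequences

end

end HigherComplex

open HigherComplex
theorem mainTheorem3 (X : Type*) [TopologicalSpace X] [T2Space X] [CompactSpace X]
    [ChartedSpace ℂ X] [IsManifold 𝓘(ℂ, ℂ) ω X] (n : ℕ) (hn : 2 ≤ n) :
    -- the pairs of a structure and a covector are exactly the solutions of the equations
    cotangentPairs X n = solutionPairs X n ∧
    -- so the cotangent bundle is the space of solutions, modulo higher diffeomorphisms
    (∃ Ψ : ModHigherDiffeos (solutionPairs X n) ≃ HitchinCotangentBundle X n,
      (∀ (q : CompatibleStructure X n × Covector X n) (h : q ∈ solutionPairs X n)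
        (h' : q ∈ cotangentPairs X n),
        Ψ (ModHigherDiffeos.mk ⟨q, h⟩) = ModHigherDiffeos.mk ⟨q, h'⟩) ∧
      ∀ a, ModHigherDiffeos.proj (Ψ a) = ModHigherDiffeos.proj a) ∧
    -- at `μ = 0` these are the tuples of holomorphic differentials
    (∀ (μ : CompatibleStructure X n) (t : Covector X n), (∀ k, μ.1 k = 0) →
      (t ∈ cotangentSpace μ ↔
        ∀ k ∈ Finset.Icc 2 n, ∀ e : atlas ℂ X, DifferentiableOn ℂ (t.1 k e) e.1.target)) :=
  ⟨cotangentPairs_eq_solutionPairs,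
    exists_equiv_modHigherDiffeos cotangentPairs_eq_solutionPairs.symm,
    mem_cotangentSpace_zero_iff⟩
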